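/- Let $\mathcal{S}$ be a smooth spacelike hypersurface of a smooth four-dimensional Lorentzian manifold $(\mathcal{M},g)$ of signature $(+,-,-,-)$ with a spin structure. Let $\tau^{AA'}$ be the spinor of the normal to $\mathcal{S}$, normalised by $\tau_{AA'}\tau^{AA'}=2$, and let $\mathcal{D}_{AB}=\tau_{(A}{}^{A'}\nabla_{B)A'}$ be the Sen derivative of spinor fields on $\mathcal{S}$. Let $\Psi_{ABCD}=\Psi_{(ABCD)}$ and $Y_{ABCC'}=Y_{(ABC)C'}$ be the (smooth) Weyl and Cotton spinors of an initial data set on $\mathcal{S}$ for the alternative conformal Einstein field equations, put $Y_{ABCD}=\tau_D{}^{D'}Y_{ABCD'}$, and assume the constraint $$\mathcal{D}^{PQ}\Psi_{PQAB}-\tfrac12 Y_{AB}{}^{Q}{}_{Q}=0 .$$ Let $\mathcal{U}\subset\mathcal{S}$ be open, let $\kappa_{AB}=\kappa_{(AB)}$ be a smooth spinor field on $\mathcal{U}$, put $\xi_{AB}=\mathcal{D}_{(A}{}^{D}\kappa_{B)D}$, and consider the conditions $$\text{(C1)}\quad \mathcal{D}_{(AB}\kappa_{CD)}=0,\qquad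 \text{(C2)}\quad \kappa_{(A}{}^{F}\Psi_{BCD)F}=0,$$ $$\text{(C3)}\quad \kappa_{(A}{}^{F}Y_{BCD)F}+2\kappa_{(A}{}^{F}\mathcal{D}_{|F|}{}^{G}\Psi_{BCD)G}+\Psi_{(ABC}{}^{F}\xi_{D)F}=0 .$$ A dyad on an open set is a pair of smooth spinor fields $o^A,\iota^A$ with $o_A\iota^A=1$. The components of $Y_{ABCD}$ in a dyad are $$Y_0=Y_{ABCD}\iota^A\iota^B\iota^C\iota^D,\quad Y_1=Y_{ABCD}\iota^A\iota^B\iota^C o^D,\quad Y_2=Y_{ABCD}\iota^A\iota^B o^C\iota^D,\quad Y_3=Y_{ABCD}\iota^A\iota^B o^C o^D,$$ $$Y_4=Y_{ABCD}\iota^A o^B o^C\iota^D,\quad Y_5=Y_{ABCD}\iota^A o^B o^C o^D,\quad Y_6=Y_{ABCD}o^A o^B o^C\iota^D,\quad Y_7=Y_{ABCD}o^A o^B o^C o^D .$$ (i) Suppose $\kappa_{AB}\kappa^{AB}\neq 0$ everywhere on $\mathcal{U}$. Then every point of $\mathcal{U}$ has an open neighbourhood in $\mathcal{U}$ on which there are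 a dyad and a smooth complex-valued function $\varkappa$ with $\kappa_{AB}=e^{\varkappa}o_{(A}\iota_{B)}$. For every such dyad, defined on an open set $\mathcal{V}\subset\mathcal{U}$ on which (C1) and (C2) hold, and at every point of $\mathcal{V}$, condition (C3) is equivalent to $$Y_0=Y_1=Y_6=Y_7=0 .$$ (ii) Suppose $\kappa_{AB}\kappa^{AB}=0$ and $\kappa_{AB}\neq 0$ everywhere on $\mathcal{U}$. Then every point of $\mathcal{U}$ has an open neighbourhood in $\mathcal{U}$ on which there is a dyad with $\kappa_{AB}=o_Ao_B$. For every such dyad, defined on an open set $\mathcal{V}\subset\mathcal{U}$ on which (C1) and (C2) hold, and at every point of $\mathcal{V}$, condition (C3) is equivalent to $$Y_2=Y_3=Y_4=Y_5=Y_6=Y_7=0 .$$ -/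

import Mathlib

open scoped Manifold ContDiff BigOperators

noncomputable section

/-! ### Spinor algebra

Spinors are written in components with respect to a spin frame. `ε_{01} = ε^{01} = 1`, and indices
are moved by `ψ^A = ε^{AB} ψ_B`, `ψ_B = ψ^A ε_{AB}`. -/

/-- Components `φ_{A₁ ⋯ Aₙ}` of a valence `n` covariant spinor. -/
abbrev Spinor (n : ℕ) : Type := (Fin n → Fin 2) → ℂ

/-- The components of `ε_{AB}`, and also of `ε^{AB}`. -/
def eps : Fin 2 → Fin 2 → ℂ := !![0, 1; -1, 0]

/-- Total symmetrisation `T_{(A₁ ⋯ Aₙ)}`. -/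
def symmetrize {n : ℕ} (T : Spinor n) : Spinor n :=
  fun i => (n.factorial : ℂ)⁻¹ * ∑ σ : Equiv.Perm (Fin n), T (i ∘ σ)

/-- `T_{A₁ ⋯ Aₙ} = T_{(A₁ ⋯ Aₙ)}`. -/
def IsSymmetricSpinor {n : ℕ} (T : Spinor n) : Prop :=
  ∀ (σ : Equiv.Perm (Fin n)) (i : Fin n → Fin 2), T (i ∘ σ) = T i

/-- `o_A = o^B ε_{BA}`. -/
def lowerIdx (o : Fin 2 → ℂ) : Fin 2 → ℂ := fun A => ∑ B, o B * eps B A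

/-- `κ_{AB} κ^{AB}`. -/
def selfContraction (κ : Spinor 2) : ℂ :=
  ∑ A, ∑ B, ∑ C, ∑ D, κ ![A, B] * eps A C * eps B D * κ ![C, D]

/-! ### Spacetime, spin frame and spin connection -/

/-- `η_{aa}` for the signature `(+,-,-,-)`. -/
def eta : Fin 4 → ℝ := ![1, -1, -1, -1]

/-- The Infeld–van der Waerden symbols `σ_a^{AA'}`. -/
def infeld : Fin 4 → Fin 2 → Fin 2 → ℂ := fun a A A' =>
  ((Real.sqrt 2 : ℝ) : ℂ)⁻¹ *
    (![!![1, 0; 0, 1], !![0, 1; 1, 0], !![0, Complex.I; -Complex.I, 0], !![1, 0; 0, -1]] :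
      Fin 4 → Matrix (Fin 2) (Fin 2) ℂ) a A A'

/-- The inverse symbols `σ^a_{AA'} = η^{ab} σ_b^{BB'} ε_{BA} ε_{B'A'}`. -/
def infeldInv : Fin 4 → Fin 2 → Fin 2 → ℂ := fun a A A' =>
  (eta a : ℂ) * ∑ B, ∑ B', infeld a B B' * eps B A * eps B' A'

/-- A four-dimensional Lorentzian manifold with a spin structure. The spin structure is presented
by a global smooth orthonormal frame `e_0, …, e_3`; spinors are given by their components with
respect to the spin frame whose associated tetrad is `(e_a)`. -/
structure SpinSpacetime (M : Type*) [TopologicalSpace M]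
    [ChartedSpace (EuclideanSpace ℝ (Fin 4)) M] [IsManifold (𝓡 4) ∞ M] where
  /-- the spacetime metric -/
  metric : ∀ p : M, TangentSpace (𝓡 4) p →L[ℝ] TangentSpace (𝓡 4) p →L[ℝ] ℝ
  /-- the tetrad `e_a` -/
  tetrad : Fin 4 → ∀ p : M, TangentSpace (𝓡 4) p
  tetrad_smooth : ∀ a, ContMDiff (𝓡 4) (𝓡 4).tangent ∞
    (fun p => (⟨p, tetrad a p⟩ : TangentBundle (𝓡 4) M))
  tetrad_orthonormal : ∀ p a b, metric p (tetrad a p) (tetrad b p) = if a = b then eta a else 0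

namespace SpinSpacetime

variable {M : Type*} [TopologicalSpace M] [ChartedSpace (EuclideanSpace ℝ (Fin 4)) M]
  [IsManifold (𝓡 4) ∞ M] (𝓜 : SpinSpacetime M)

/-- `g([e_a, e_b], e_c)`. -/
def structureCoeff (p : M) (a b c : Fin 4) : ℝ :=
  𝓜.metric p (VectorField.mlieBracket (𝓡 4) (𝓜.tetrad a) (𝓜.tetrad b) p) (𝓜.tetrad c p)

/-- The Levi-Civita connection `g(∇_{e_a} e_b, e_c)` in the tetrad, from the Koszul formula. -/
def leviCivitaCoeff (p : M) (a b c : Fin 4) : ℝ :=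
  (𝓜.structureCoeff p a b c - 𝓜.structureCoeff p b c a + 𝓜.structureCoeff p c a b) / 2

/-- The spin connection `γ_{a B}^C`, defined by `∇_{e_a} ε_B = γ_{a B}^C ε_C` for the spin frame
`(ε_0, ε_1)`; explicitly `γ_{a B}^C = ½ σ^b_{BQ'} (∇_{e_a} e_b)^c σ_c^{CQ'}`. -/
def spinConnection (p : M) (a : Fin 4) (B C : Fin 2) : ℂ :=
  (1 / 2) * ∑ b, ∑ c, ∑ Q', infeldInv b B Q' * ((eta c * 𝓜.leviCivitaCoeff p a b c : ℝ) : ℂ) *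
    infeld c C Q'

end SpinSpacetime

/-! ### Spacelike hypersurfaces and the Sen derivative -/

/-- An embedded spacelike hypersurface `S` of a spacetime, with a unit normal. -/
structure SpacelikeHypersurface {M : Type*} [TopologicalSpace M]
    [ChartedSpace (EuclideanSpace ℝ (Fin 4)) M] [IsManifold (𝓡 4) ∞ M] (𝓜 : SpinSpacetime M)
    (S : Type*) [TopologicalSpace S] [ChartedSpace (EuclideanSpace ℝ (Fin 3)) S]
    [IsManifold (𝓡 3) ∞ S] where
  /-- the inclusion of `S` into the spacetime -/
  emb : S → M
  emb_smooth : ContMDiff (𝓡 3) (𝓡 4) ∞ emb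
  emb_isEmbedding : Topology.IsEmbedding emb
  emb_immersion : ∀ p, Function.Injective (mfderiv (𝓡 3) (𝓡 4) emb p)
  /-- the unit normal, a timelike vector field along `S` -/
  normal : ∀ p : S, TangentSpace (𝓡 4) (emb p)
  normal_smooth : ContMDiff (𝓡 3) (𝓡 4).tangent ∞
    (fun p => (⟨emb p, normal p⟩ : TangentBundle (𝓡 4) M))
  normal_unit : ∀ p, 𝓜.metric (emb p) (normal p) (normal p) = 1
  normal_orthogonal : ∀ p (v : TangentSpace (𝓡 3) p),
    𝓜.metric (emb p) (normal p) (mfderiv (𝓡 3) (𝓡 4) emb p v) = 0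

namespace SpacelikeHypersurface

variable {M : Type*} [TopologicalSpace M] [ChartedSpace (EuclideanSpace ℝ (Fin 4)) M]
  [IsManifold (𝓡 4) ∞ M] {𝓜 : SpinSpacetime M}
  {S : Type*} [TopologicalSpace S] [ChartedSpace (EuclideanSpace ℝ (Fin 3)) S]
  [IsManifold (𝓡 3) ∞ S] (H : SpacelikeHypersurface 𝓜 S)

/-- Tetrad components `τ^a` of the normal, normalised by `τ_a τ^a = 2`. -/
def tauVec (p : S) (a : Fin 4) : ℝ :=
  Real.sqrt 2 * (eta a * 𝓜.metric (H.emb p) (H.normal p) (𝓜.tetrad a (H.emb p)))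

/-- `τ^{AA'}`. -/
def tau (p : S) (A A' : Fin 2) : ℂ := ∑ a, (H.tauVec p a : ℂ) * infeld a A A'

/-- `τ_A^{A'} = τ^{BA'} ε_{BA}`. -/
def tauMixed (p : S) (A A' : Fin 2) : ℂ := ∑ B, H.tau p B A' * eps B A

/-- The tetrad components `X_{AB}^a` of the complex vectors `X_{AB} = τ_{(A}^{A'} e_{B)A'}` tangent
to `S`, where `e_{AA'} = σ^a_{AA'} e_a`; the Sen derivative is `𝒟_{AB} = ∇_{X_{AB}}`. -/
def senVec (p : S) (A B : Fin 2) (a : Fin 4) : ℂ :=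
  (1 / 2) * ∑ A', (H.tauMixed p A A' * infeldInv a B A' + H.tauMixed p B A' * infeldInv a A A')

/-- The vector tangent to `S` whose push-forward along the inclusion is `v`; only used for `v`
orthogonal to the normal, in which case it exists and is unique (`mfderiv_tangentLift`). -/
def tangentLift (p : S) (v : TangentSpace (𝓡 4) (H.emb p)) : TangentSpace (𝓡 3) p :=
  Function.invFun (mfderiv (𝓡 3) (𝓡 4) H.emb p) v

theorem mfderiv_tangentLift (p : S) (v : TangentSpace (𝓡 4) (H.emb p))
    (hv : 𝓜.metric (H.emb p) (H.normal p) v = 0) :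
    mfderiv (𝓡 3) (𝓡 4) H.emb p (H.tangentLift p v) = v := by
  refine Function.invFun_eq ?_
  let j : EuclideanSpace ℝ (Fin 3) →ₗ[ℝ] EuclideanSpace ℝ (Fin 4) :=
    (mfderiv (𝓡 3) (𝓡 4) H.emb p).toLinearMap
  let n : EuclideanSpace ℝ (Fin 4) →ₗ[ℝ] ℝ :=
    (𝓜.metric (H.emb p) (H.normal p)).toLinearMap
  have hle : LinearMap.range j ≤ LinearMap.ker n := by
    rintro _ ⟨u, rfl⟩
    exact H.normal_orthogonal p u
  have hj : Module.finrank ℝ (LinearMap.range j) = 3 := by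
    rw [LinearMap.finrank_range_of_inj (f := j) (H.emb_immersion p)]
    simp
  have hn : LinearMap.range n = ⊤ := by
    rw [LinearMap.range_eq_top]
    intro t
    have h1 : 𝓜.metric (H.emb p) (H.normal p) (t • H.normal p) = t := by
      rw [map_smul, H.normal_unit p, smul_eq_mul, mul_one]
    exact ⟨t • H.normal p, h1⟩
  have hk : Module.finrank ℝ (LinearMap.ker n) = 3 := by
    have h := LinearMap.finrank_range_add_finrank_ker n
    rw [hn, finrank_top] at h
    simp at h
    omega
  have heq := Submodule.eq_of_le_of_finrank_eq hle (hj.trans hk.symm)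
  have hmem : (v : EuclideanSpace ℝ (Fin 4)) ∈ LinearMap.ker n := hv
  rw [← heq] at hmem
  exact hmem

/-- The differential of a complex function on `S`. -/
def differential (f : S → ℂ) (p : S) (v : TangentSpace (𝓡 3) p) : ℂ :=
  mfderiv (𝓡 3) 𝓘(ℝ, ℂ) f p v

/-- Derivative of a complex function on `S` along the complex tangent vector `w^a e_a`. -/
def dirDeriv (w : Fin 4 → ℂ) (f : S → ℂ) (p : S) : ℂ :=
  differential f p (H.tangentLift p (∑ a, (w a).re • 𝓜.tetrad a (H.emb p))) +
    Complex.I * differential f p (H.tangentLift p (∑ a, (w a).im • 𝓜.tetrad a (H.emb p)))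

/-- The Sen derivative `𝒟_{AB} φ_{C₁ ⋯ Cₙ}` of a spinor field on `S`. -/
def sen {n : ℕ} (φ : S → Spinor n) (p : S) (A B : Fin 2) : Spinor n := fun i =>
  H.dirDeriv (H.senVec p A B) (fun q => φ q i) p -
    ∑ k, ∑ Q, (∑ a, H.senVec p A B a * 𝓜.spinConnection (H.emb p) a (i k) Q) *
      φ p (Function.update i k Q)

/-- `ξ_{AB} = 𝒟_{(A}^D κ_{B)D}`. -/
def xi (κ : S → Spinor 2) (p : S) : Spinor 2 :=
  symmetrize fun i => ∑ D, ∑ E, eps D E * H.sen κ p (i 0) E ![i 1, D]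

/-- The space spinor `Y_{ABCD} = τ_D^{D'} Y_{ABCD'}` of a spinor `Y_{ABCC'}`. -/
def spaceCotton (Y : S → Fin 2 → Spinor 3) (p : S) : Spinor 4 := fun i =>
  ∑ D', H.tauMixed p (i 3) D' * Y p D' ![i 0, i 1, i 2]

end SpacelikeHypersurface

/-- Smoothness of a spinor field on a subset of `S`. -/
def SmoothSpinorOn {S : Type*} [TopologicalSpace S] [ChartedSpace (EuclideanSpace ℝ (Fin 3)) S]
    {n : ℕ} (φ : S → Spinor n) (U : Set S) : Prop :=
  ∀ i, ContMDiffOn (𝓡 3) 𝓘(ℝ, ℂ) ∞ (fun p => φ p i) U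

/-! ### Initial data and the conformal Killing spinor initial data equations -/

/-- The Weyl spinor `Ψ_{ABCD} = Ψ_{(ABCD)}` and the Cotton spinor `Y_{ABCC'} = Y_{(ABC)C'}` of an
initial data set on `S` for the alternative conformal Einstein field equations, subject to the
constraint `𝒟^{PQ} Ψ_{PQAB} - ½ Y_{AB}^Q_Q = 0`. Both fields are unknowns of that system, so they
range over all solutions of the constraint; in particular this covers the restrictions to `S` of
the Weyl and Cotton spinors of a solution. The other unknowns and constraints of the system are not
used and not imposed. -/
structure CFEInitialData {M : Type*} [TopologicalSpace M]
    [ChartedSpace (EuclideanSpace ℝ (Fin 4)) M] [IsManifold (𝓡 4) ∞ M] {𝓜 : SpinSpacetime M}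
    {S : Type*} [TopologicalSpace S] [ChartedSpace (EuclideanSpace ℝ (Fin 3)) S]
    [IsManifold (𝓡 3) ∞ S] (H : SpacelikeHypersurface 𝓜 S) where
  weyl : S → Spinor 4
  /-- `cotton p C' ![A, B, C]` is `Y_{ABCC'}` at `p`. -/
  cotton : S → Fin 2 → Spinor 3
  weyl_smooth : SmoothSpinorOn weyl Set.univ
  cotton_smooth : ∀ C', SmoothSpinorOn (fun p => cotton p C') Set.univ
  weyl_symm : ∀ p, IsSymmetricSpinor (weyl p)
  cotton_symm : ∀ p C', IsSymmetricSpinor (cotton p C')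
  weyl_constraint : ∀ p A B,
    (∑ P, ∑ Q, ∑ R, ∑ T, eps P R * eps Q T * H.sen weyl p R T ![P, Q, A, B]) -
      (1 / 2) * ∑ Q, ∑ R, eps Q R * H.spaceCotton cotton p ![A, B, R, Q] = 0

section Conditions

variable {M : Type*} [TopologicalSpace M] [ChartedSpace (EuclideanSpace ℝ (Fin 4)) M]
  [IsManifold (𝓡 4) ∞ M] {𝓜 : SpinSpacetime M}
  {S : Type*} [TopologicalSpace S] [ChartedSpace (EuclideanSpace ℝ (Fin 3)) S]
  [IsManifold (𝓡 3) ∞ S] {H : SpacelikeHypersurface 𝓜 S}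

/-- (C1) `𝒟_{(AB} κ_{CD)} = 0` at `p`. -/
def CondC1 (H : SpacelikeHypersurface 𝓜 S) (κ : S → Spinor 2) (p : S) : Prop :=
  symmetrize (fun i : Fin 4 → Fin 2 => H.sen κ p (i 0) (i 1) ![i 2, i 3]) = 0

/-- (C2) `κ_{(A}^F Ψ_{BCD)F} = 0` at `p`. -/
def CondC2 (d : CFEInitialData H) (κ : S → Spinor 2) (p : S) : Prop :=
  symmetrize (fun i : Fin 4 → Fin 2 =>
    ∑ F, ∑ G, eps F G * κ p ![i 0, G] * d.weyl p ![i 1, i 2, i 3, F]) = 0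

/-- (C3) `κ_{(A}^F Y_{BCD)F} + 2 κ_{(A}^F 𝒟_{|F|}^G Ψ_{BCD)G} + Ψ_{(ABC}^F ξ_{D)F} = 0` at `p`. -/
def CondC3 (d : CFEInitialData H) (κ : S → Spinor 2) (p : S) : Prop :=
  symmetrize (fun i : Fin 4 → Fin 2 =>
    (∑ F, ∑ K, eps F K * κ p ![i 0, K] * H.spaceCotton d.cotton p ![i 1, i 2, i 3, F]) +
    2 * (∑ F, ∑ K, ∑ G, ∑ L, eps F K * κ p ![i 0, K] *
      (eps G L * H.sen d.weyl p F L ![i 1, i 2, i 3, G])) +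
    (∑ F, ∑ K, eps F K * d.weyl p ![i 0, i 1, i 2, K] * H.xi κ p ![i 3, F])) = 0

/-- The components `Y_0, …, Y_7` of `Y_{ABCD}` with respect to the dyad `(o^A, ι^A)`. -/
def cottonComponent (d : CFEInitialData H) (o ι : S → Fin 2 → ℂ) (p : S) : Fin 8 → ℂ :=
  let y : (a b c e : Fin 2 → ℂ) → ℂ := fun a b c e =>
    ∑ A, ∑ B, ∑ C, ∑ D, a A * b B * c C * e D * H.spaceCotton d.cotton p ![A, B, C, D]
  ![y (ι p) (ι p) (ι p) (ι p), y (ι p) (ι p) (ι p) (o p), y (ι p) (ι p) (o p) (ι p),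
    y (ι p) (ι p) (o p) (o p), y (ι p) (o p) (o p) (ι p), y (ι p) (o p) (o p) (o p),
    y (o p) (o p) (o p) (ι p), y (o p) (o p) (o p) (o p)]

end Conditions

section Dyads

variable {S : Type*} [TopologicalSpace S] [ChartedSpace (EuclideanSpace ℝ (Fin 3)) S]

/-- `(o^A, ι^A)` is a smooth spin dyad on `V`, normalised by `o_A ι^A = 1`. -/
structure IsSpinDyadOn (o ι : S → Fin 2 → ℂ) (V : Set S) : Prop where
  smooth_o : ∀ A, ContMDiffOn (𝓡 3) 𝓘(ℝ, ℂ) ∞ (fun p => o p A) V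
  smooth_iota : ∀ A, ContMDiffOn (𝓡 3) 𝓘(ℝ, ℂ) ∞ (fun p => ι p A) V
  normalised : ∀ p ∈ V, ∑ A, lowerIdx (o p) A * ι p A = 1

/-- The dyad and the scalar field `ϰ` satisfy `κ_{AB} = e^ϰ o_{(A} ι_{B)}` on `V`. -/
structure IsTypeDAdapted (κ : S → Spinor 2) (o ι : S → Fin 2 → ℂ) (ϰ : S → ℂ) (V : Set S) :
    Prop where
  dyad : IsSpinDyadOn o ι V
  smooth : ContMDiffOn (𝓡 3) 𝓘(ℝ, ℂ) ∞ ϰ V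
  eq : ∀ p ∈ V, κ p = Complex.exp (ϰ p) •
    symmetrize (fun i : Fin 2 → Fin 2 => lowerIdx (o p) (i 0) * lowerIdx (ι p) (i 1))

/-- The dyad satisfies `κ_{AB} = o_A o_B` on `V`. -/
structure IsTypeNAdapted (κ : S → Spinor 2) (o ι : S → Fin 2 → ℂ) (V : Set S) : Prop where
  dyad : IsSpinDyadOn o ι V
  eq : ∀ p ∈ V, κ p = fun i => lowerIdx (o p) (i 0) * lowerIdx (o p) (i 1)

end Dyads

end

/-! Condition (C2) says that `κ`, acting on `Ψ` as an element of `sl(2)`, annihilates it. In a dyad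
adapted to `κ` this action is diagonal (non-null case) or nilpotent (null case). Its kernel on
quartic spinors is one-dimensional, spanned by `κ_{(AB} κ_{CD)}`, so `Ψ = f κκ`
(`eq_symProd_of_typeD`, `eq_symProd_of_typeN`). As (C2) holds on an open set, `f` is a function
there. It is smooth, being built from a component of `Ψ` in the smooth dyad and, in the non-null
case, `e^ϰ`.

The Leibniz rule now gives `𝒟Ψ = (𝒟f) κκ + 2 f κ 𝒟κ` (`sen_eq_of_eq_symProd`), and at a point (C3)
becomes polynomial in `κ`, `f`, `𝒟f`, `𝒟κ` and `Y`. By (C1) the totally symmetric part of `𝒟κ` drops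
out. The remaining derivative terms of (C3) either cancel or assemble into components of the
divergence `𝒟^{PQ} Ψ_{PQAB}`, which the constraint replaces by half the trace `Y_{AB}^Q_Q`. Only
components of `Y` survive.

Non-null case (`FrameData.typeD`): four of the five components of (C3) are nonzero multiples of
`Y_0`, `Y_1`, `Y_6`, `Y_7`, and the middle one vanishes identically. Null case (`FrameData.typeN`):
the component along `o^A o^B o^C o^D` vanishes, the other four are nonzero multiples of `Y_2`,
`Y_3`, `Y_5`, `Y_7`, and two components of the constraint identify `Y_5 = Y_6` and `Y_3 = Y_4`. The
latter uses that `𝒟_{AB}(o_C o_D)` vanishes when contracted with `o^C o^D` (`fr4_sen_null`).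

These computations are short only in the dyad, whereas the fields are given in the background spin
frame. Every ingredient is built from `ε`-contractions, which do not change under unimodular frame
changes (`contraction_frame`); `frameData_and_condC3_iff` carries out the transfer. Throughout,
frame index `0` means contraction with `o^A` and `1` with `ι^A`.

The local dyads come from factorising the quadratic form `κ`, with smooth square roots supplied by
`exists_local_log`. -/

noncomputable section

set_option linter.unusedSectionVars false
set_option linter.unusedSimpArgs false

/-! ### Frame components and total symmetrisation of spinors. -/

section FrameAlgebra

/-- Contraction of one spinor index with the vectors of the frame `m`. -/
def fr (m : Fin 2 → Fin 2 → ℂ) (u : Fin 2 → ℂ) (a : Fin 2) : ℂ := ∑ A, m a A * u A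

/-- Frame components of a valence two spinor. -/
def fr2 (m : Fin 2 → Fin 2 → ℂ) (T : Fin 2 → Fin 2 → ℂ) (a b : Fin 2) : ℂ :=
  fr m (fun A => fr m (T A) b) a

/-- Frame components of a valence four spinor. -/
def fr4 (m : Fin 2 → Fin 2 → ℂ) (T : Fin 2 → Fin 2 → Fin 2 → Fin 2 → ℂ) (a b c d : Fin 2) : ℂ :=
  fr2 m (fun A B => fr2 m (T A B) c d) a b

/-- Frame components of a valence six spinor. -/
def fr6 (m : Fin 2 → Fin 2 → ℂ) (T : Fin 2 → Fin 2 → Fin 2 → Fin 2 → Fin 2 → Fin 2 → ℂ)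
    (a b c d e f : Fin 2) : ℂ :=
  fr2 m (fun A B => fr4 m (T A B) c d e f) a b

theorem fr_injective {m : Fin 2 → Fin 2 → ℂ} (hm : m 0 0 * m 1 1 - m 0 1 * m 1 0 = 1)
    {u v : Fin 2 → ℂ} (h : ∀ a, fr m u a = fr m v a) : u = v := by
  have h0 := h 0
  have h1 := h 1
  simp only [fr, Fin.sum_univ_two] at h0 h1
  ext A
  fin_cases A
  · show u 0 = v 0
    linear_combination m 1 1 * h0 - m 0 1 * h1 - (u 0 - v 0) * hm
  · show u 1 = v 1
    linear_combination m 0 0 * h1 - m 1 0 * h0 - (u 1 - v 1) * hm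

theorem fr2_injective {m : Fin 2 → Fin 2 → ℂ} (hm : m 0 0 * m 1 1 - m 0 1 * m 1 0 = 1)
    {S T : Fin 2 → Fin 2 → ℂ} (h : ∀ a b, fr2 m S a b = fr2 m T a b) : S = T := by
  ext A B
  have h1 : ∀ b, (fun A => fr m (S A) b) = fun A => fr m (T A) b :=
    fun b => fr_injective hm fun a => h a b
  exact congrFun (fr_injective hm fun b => congrFun (h1 b) A) B

theorem fr4_injective {m : Fin 2 → Fin 2 → ℂ} (hm : m 0 0 * m 1 1 - m 0 1 * m 1 0 = 1)
    {S T : Fin 2 → Fin 2 → Fin 2 → Fin 2 → ℂ}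
    (h : ∀ a b c d, fr4 m S a b c d = fr4 m T a b c d) : S = T := by
  ext A B C D
  have h1 : ∀ c d, (fun A B => fr2 m (S A B) c d) = fun A B => fr2 m (T A B) c d :=
    fun c d => fr2_injective hm fun a b => h a b c d
  exact congrFun₂ (fr2_injective hm fun c d => congrFun₂ (h1 c d) A B) C D

/-- The contraction `X_K^K` may be computed in any unimodular frame. -/
theorem contraction_frame {m : Fin 2 → Fin 2 → ℂ} (hm : m 0 0 * m 1 1 - m 0 1 * m 1 0 = 1)
    (X : Fin 2 → Fin 2 → ℂ) :
    ∑ F, ∑ K, eps F K * X K F = ∑ F, ∑ K, eps F K * fr2 m X K F := by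
  simp only [fr2, fr, Fin.sum_univ_two, eps, Matrix.of_apply, Matrix.cons_val', Matrix.cons_val_zero,
    Matrix.cons_val_one, Matrix.cons_val_fin_one]
  linear_combination (X 0 1 - X 1 0) * hm

/-- The values of `T_{ABCD} v^A v^B v^C v^D`. -/
def quartic (T : Fin 2 → Fin 2 → Fin 2 → Fin 2 → ℂ) (v : Fin 2 → ℂ) : ℂ :=
  ∑ A, ∑ B, ∑ C, ∑ D, v A * v B * v C * v D * T A B C D

/-- The five independent components of `T_{(ABCD)}` vanish. -/
structure SymVanish (T : Fin 2 → Fin 2 → Fin 2 → Fin 2 → ℂ) : Prop where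
  zero : T 0 0 0 0 = 0
  one : T 0 0 0 1 + T 0 0 1 0 + T 0 1 0 0 + T 1 0 0 0 = 0
  two : T 0 0 1 1 + T 0 1 0 1 + T 0 1 1 0 + T 1 0 0 1 + T 1 0 1 0 + T 1 1 0 0 = 0
  three : T 0 1 1 1 + T 1 0 1 1 + T 1 1 0 1 + T 1 1 1 0 = 0
  four : T 1 1 1 1 = 0

/-- The five sums are the coefficients of a binary quartic form in `v`. Passing to the form makes
invariance under frame changes and under symmetrisation immediate. -/
theorem symVanish_iff_quartic (T : Fin 2 → Fin 2 → Fin 2 → Fin 2 → ℂ) :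
    SymVanish T ↔ ∀ v, quartic T v = 0 := by
  have key : ∀ v, quartic T v = v 0 ^ 4 * T 0 0 0 0
      + v 0 ^ 3 * v 1 * (T 0 0 0 1 + T 0 0 1 0 + T 0 1 0 0 + T 1 0 0 0)
      + v 0 ^ 2 * v 1 ^ 2 *
        (T 0 0 1 1 + T 0 1 0 1 + T 0 1 1 0 + T 1 0 0 1 + T 1 0 1 0 + T 1 1 0 0)
      + v 0 * v 1 ^ 3 * (T 0 1 1 1 + T 1 0 1 1 + T 1 1 0 1 + T 1 1 1 0)
      + v 1 ^ 4 * T 1 1 1 1 := by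
    intro v
    simp only [quartic, Fin.sum_univ_two]
    ring
  constructor
  · rintro ⟨h0, h1, h2, h3, h4⟩ v
    rw [key, h0, h1, h2, h3, h4]
    ring
  · intro h
    -- A binary quartic is determined by its values at five pairwise non-proportional vectors; the
    -- coefficients below invert this interpolation problem.
    have e0 := (key ![1, 0]).symm.trans (h _)
    have e1 := (key ![0, 1]).symm.trans (h _)
    have e2 := (key ![1, 1]).symm.trans (h _)
    have e3 := (key ![1, -1]).symm.trans (h _)
    have e4 := (key ![1, 2]).symm.trans (h _)
    simp only [Matrix.cons_val_zero, Matrix.cons_val_one] at e0 e1 e2 e3 e4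
    constructor
    · linear_combination e0
    · linear_combination (-1/2) * e0 + 2 * e1 + e2 - (1/3) * e3 - (1/6) * e4
    · linear_combination -e0 - e1 + (1/2) * e2 + (1/2) * e3
    · linear_combination (1/2) * e0 - 2 * e1 - (1/2) * e2 - (1/6) * e3 + (1/6) * e4
    · linear_combination e1

theorem quartic_frame (m : Fin 2 → Fin 2 → ℂ) (T : Fin 2 → Fin 2 → Fin 2 → Fin 2 → ℂ)
    (v : Fin 2 → ℂ) : quartic (fr4 m T) v = quartic T fun A => ∑ a, v a * m a A := by
  simp only [quartic, fr4, fr2, fr, Fin.sum_univ_two]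
  ring

theorem symVanish_frame {m : Fin 2 → Fin 2 → ℂ} (hm : m 0 0 * m 1 1 - m 0 1 * m 1 0 = 1)
    (T : Fin 2 → Fin 2 → Fin 2 → Fin 2 → ℂ) : SymVanish (fr4 m T) ↔ SymVanish T := by
  rw [symVanish_iff_quartic, symVanish_iff_quartic]
  refine ⟨fun h v => ?_, fun h v => (quartic_frame m T v).trans (h _)⟩
  -- The coordinates of `v` in the frame, by Cramer's rule with determinant `1`.
  have hv : v = fun A => ∑ a,
      (![v 0 * m 1 1 - v 1 * m 1 0, v 1 * m 0 0 - v 0 * m 0 1] : Fin 2 → ℂ) a * m a A := by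
    ext A
    fin_cases A <;> simp [Fin.sum_univ_two]
    · linear_combination - v 0 * hm
    · linear_combination - v 1 * hm
  rw [hv, ← quartic_frame]
  exact h _

theorem sum_fin_succ_pi {α β : Type*} [Fintype α] [AddCommMonoid β] {n : ℕ}
    (f : (Fin (n + 1) → α) → β) : ∑ i, f i = ∑ a, ∑ i : Fin n → α, f (Matrix.vecCons a i) := by
  rw [← (Fin.consEquiv fun _ : Fin (n + 1) => α).sum_comp, Fintype.sum_prod_type]
  rfl

theorem sum_spinor_four (f : (Fin 4 → Fin 2) → ℂ) :
    ∑ i, f i = ∑ A, ∑ B, ∑ C, ∑ D, f ![A, B, C, D] := by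
  simp only [sum_fin_succ_pi, Finset.univ_unique, Finset.sum_singleton]
  rfl

theorem symmetrize_isSymmetric {n : ℕ} (T : Spinor n) : IsSymmetricSpinor (symmetrize T) := by
  intro σ i
  simp only [symmetrize]
  congr 1
  exact Equiv.sum_comp (Equiv.mulLeft σ) fun τ : Equiv.Perm (Fin n) => T (i ∘ τ)

/-- The weight `∏ v (i k)` is invariant under permuting the indices, so all `n!` terms of the
symmetrisation contribute equally. -/
theorem sum_symmetrize_mul_prod {n : ℕ} (T : Spinor n) (v : Fin 2 → ℂ) :
    ∑ i, symmetrize T i * ∏ k, v (i k) = ∑ i, T i * ∏ k, v (i k) := by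
  have h : ∀ σ : Equiv.Perm (Fin n),
      ∑ i : Fin n → Fin 2, T (i ∘ σ) * ∏ k, v (i k) = ∑ i, T i * ∏ k, v (i k) := by
    intro σ
    rw [← (σ.arrowCongr (Equiv.refl (Fin 2))).sum_comp
      fun i => T (i ∘ σ) * ∏ k, v (i k)]
    refine Finset.sum_congr rfl fun i _ => ?_
    congr 1
    · congr 1
      ext k
      simp
    · exact σ.symm.prod_comp fun k => v (i k)
  simp only [symmetrize, mul_assoc, Finset.sum_mul]
  rw [← Finset.mul_sum, Finset.sum_comm]
  simp only [h, Finset.sum_const, Finset.card_univ, Fintype.card_perm, Fintype.card_fin,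
    nsmul_eq_mul]
  rw [← mul_assoc, inv_mul_cancel₀ (by exact_mod_cast n.factorial_ne_zero), one_mul]

/-- Components of a valence four spinor as a function of four indices. -/
abbrev curry4 (T : Spinor 4) (A B C D : Fin 2) : ℂ := T ![A, B, C, D]

theorem quartic_symmetrize (T : Spinor 4) (v : Fin 2 → ℂ) :
    quartic (curry4 (symmetrize T)) v = quartic (curry4 T) v := by
  have h := sum_symmetrize_mul_prod T v
  simp only [sum_spinor_four, Fin.prod_univ_four] at h
  simpa [quartic, mul_comm, mul_assoc, mul_left_comm] using h

theorem IsSymmetricSpinor.swap01 {T : Spinor 4} (h : IsSymmetricSpinor T) (A B C D : Fin 2) :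
    T ![A, B, C, D] = T ![B, A, C, D] := by
  rw [← h (Equiv.swap 0 1)]
  congr 1
  ext k
  fin_cases k <;> rfl

theorem IsSymmetricSpinor.swap12 {T : Spinor 4} (h : IsSymmetricSpinor T) (A B C D : Fin 2) :
    T ![A, B, C, D] = T ![A, C, B, D] := by
  rw [← h (Equiv.swap 1 2)]
  congr 1
  ext k
  fin_cases k <;> rfl

theorem IsSymmetricSpinor.swap23 {T : Spinor 4} (h : IsSymmetricSpinor T) (A B C D : Fin 2) :
    T ![A, B, C, D] = T ![A, B, D, C] := by
  rw [← h (Equiv.swap 2 3)]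
  congr 1
  ext k
  fin_cases k <;> rfl

/-- Symmetrising does not change the quartic form. For a tensor that is already symmetric the five
sums are its independent components with multiplicities `1, 4, 6, 4, 1`. -/
theorem symmetrize_eq_zero_iff (T : Spinor 4) : symmetrize T = 0 ↔ SymVanish (curry4 T) := by
  have hq : SymVanish (curry4 (symmetrize T)) ↔ SymVanish (curry4 T) := by
    simp only [symVanish_iff_quartic, quartic_symmetrize]
  rw [← hq]
  refine ⟨fun h => ?_, fun h => ?_⟩
  · rw [h]
    constructor <;> simp
  · have hs := symmetrize_isSymmetric T
    generalize symmetrize T = R at h hs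
    obtain ⟨h0, h1, h2, h3, h4⟩ := h
    simp only [curry4] at h0 h1 h2 h3 h4
    have a1 := hs.swap23 0 0 0 1
    have a2 := hs.swap12 0 0 1 0
    have a3 := hs.swap01 0 1 0 0
    have b1 := hs.swap12 0 0 1 1
    have b2 := hs.swap23 0 1 0 1
    have b3 := hs.swap01 0 1 0 1
    have b4 := hs.swap01 0 1 1 0
    have b5 := hs.swap12 1 0 1 0
    have c1 := hs.swap01 0 1 1 1
    have c2 := hs.swap12 1 0 1 1
    have c3 := hs.swap23 1 1 0 1
    have key : ∀ A B C D, R ![A, B, C, D] = 0 := by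
      intro A B C D
      fin_cases A <;> fin_cases B <;> fin_cases C <;> fin_cases D <;>
        simp only [Fin.zero_eta, Fin.mk_one] <;> grind
    ext i
    have hi : i = ![i 0, i 1, i 2, i 3] := by
      ext k
      fin_cases k <;> rfl
    rw [hi]
    exact key _ _ _ _

end FrameAlgebra

/-! ### Covariance of the terms of (C3) and of the constraint under unimodular frame changes. -/

section FrameConditions

/-- `κ_A^F Y_{BCDF}`. -/
def contractLast (κ : Fin 2 → Fin 2 → ℂ) (Y : Fin 2 → Fin 2 → Fin 2 → Fin 2 → ℂ)
    (A B C D : Fin 2) : ℂ :=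
  ∑ F, ∑ K, eps F K * κ A K * Y B C D F

/-- `P_F^G_{BCDG}`. -/
def innerDiv (P : Fin 2 → Fin 2 → Fin 2 → Fin 2 → Fin 2 → Fin 2 → ℂ) (B C D F : Fin 2) : ℂ :=
  ∑ G, ∑ L, eps G L * P F L B C D G

/-- `Ψ_{ABC}^F ξ_{DF}`. -/
def contractXi (Ψ : Fin 2 → Fin 2 → Fin 2 → Fin 2 → ℂ) (ξ : Fin 2 → Fin 2 → ℂ)
    (A B C D : Fin 2) : ℂ :=
  ∑ F, ∑ K, eps F K * Ψ A B C K * ξ D F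

/-- `K_{(A}^D_{B)D}`. -/
def xiPart (K : Fin 2 → Fin 2 → Fin 2 → Fin 2 → ℂ) (A B : Fin 2) : ℂ :=
  (1 / 2) * ((∑ D, ∑ E, eps D E * K A E B D) + ∑ D, ∑ E, eps D E * K B E A D)

/-- `P^{PQ}_{PQAB}`. -/
def fullDiv (P : Fin 2 → Fin 2 → Fin 2 → Fin 2 → Fin 2 → Fin 2 → ℂ) (A B : Fin 2) : ℂ :=
  ∑ F, ∑ Q, ∑ R, ∑ T, eps F R * eps Q T * P R T F Q A B

/-- `Y_{AB}^Q_Q`. -/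
def traceLast (Y : Fin 2 → Fin 2 → Fin 2 → Fin 2 → ℂ) (A B : Fin 2) : ℂ :=
  ∑ Q, ∑ R, eps Q R * Y A B R Q

/-- The symmetrisation `κ_{(AB} λ_{CD)}` of symmetric spinors. -/
def symProd (κ l : Fin 2 → Fin 2 → ℂ) (A B C D : Fin 2) : ℂ :=
  (κ A B * l C D + κ A C * l B D + κ A D * l B C +
    l A B * κ C D + l A C * κ B D + l A D * κ B C) / 6

/-- The left-hand side of (C3) before symmetrisation. -/
def c3Tensor (κ : Fin 2 → Fin 2 → ℂ) (Y : Fin 2 → Fin 2 → Fin 2 → Fin 2 → ℂ)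
    (P : Fin 2 → Fin 2 → Fin 2 → Fin 2 → Fin 2 → Fin 2 → ℂ)
    (Ψ K : Fin 2 → Fin 2 → Fin 2 → Fin 2 → ℂ) (A B C D : Fin 2) : ℂ :=
  contractLast κ Y A B C D + 2 * contractLast κ (innerDiv P) A B C D +
    contractXi Ψ (xiPart K) A B C D

variable {m : Fin 2 → Fin 2 → ℂ}

/-- The free indices are moved to the frame first. This leaves a single `ε`-contraction, to which
`contraction_frame` applies; the covariance lemmas below follow the same pattern. -/
theorem fr4_contractLast (hm : m 0 0 * m 1 1 - m 0 1 * m 1 0 = 1) (κ : Fin 2 → Fin 2 → ℂ)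
    (Y : Fin 2 → Fin 2 → Fin 2 → Fin 2 → ℂ) :
    fr4 m (contractLast κ Y) = contractLast (fr2 m κ) (fr4 m Y) := by
  ext a b c d
  have h1 : fr4 m (contractLast κ Y) a b c d = ∑ F, ∑ K, eps F K *
      (fun K F => fr m (fun A => κ A K) a *
        fr2 m (fun B C => fr m (fun D => Y B C D F) d) b c) K F := by
    simp only [contractLast, fr4, fr2, fr, Fin.sum_univ_two]
    ring
  rw [h1, contraction_frame hm]
  refine Finset.sum_congr rfl fun F _ => Finset.sum_congr rfl fun K _ => ?_
  rw [mul_assoc]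
  congr 1
  simp only [fr4, fr2, fr, Fin.sum_univ_two]
  ring

theorem fr4_contractXi (hm : m 0 0 * m 1 1 - m 0 1 * m 1 0 = 1)
    (Ψ : Fin 2 → Fin 2 → Fin 2 → Fin 2 → ℂ) (ξ : Fin 2 → Fin 2 → ℂ) :
    fr4 m (contractXi Ψ ξ) = contractXi (fr4 m Ψ) (fr2 m ξ) := by
  ext a b c d
  have h1 : fr4 m (contractXi Ψ ξ) a b c d = ∑ F, ∑ K, eps F K *
      (fun K F => fr m (fun A => ξ A F) d *
        fr2 m (fun B C => fr m (fun D => Ψ B C D K) c) a b) K F := by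
    simp only [contractXi, fr4, fr2, fr, Fin.sum_univ_two]
    ring
  rw [h1, contraction_frame hm]
  refine Finset.sum_congr rfl fun F _ => Finset.sum_congr rfl fun K _ => ?_
  rw [mul_assoc]
  congr 1
  simp only [fr4, fr2, fr, Fin.sum_univ_two]
  ring

theorem fr2_sum_eps (X : Fin 2 → Fin 2 → Fin 2 → Fin 2 → ℂ) (a b : Fin 2) :
    fr2 m (fun A B => ∑ F, ∑ K, eps F K * X A B K F) a b =
      ∑ F, ∑ K, eps F K * (fun K F => fr2 m (fun A B => X A B K F) a b) K F := by
  simp only [fr2, fr, Fin.sum_univ_two]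
  ring

theorem fr2_fr2_comm (X : Fin 2 → Fin 2 → Fin 2 → Fin 2 → ℂ) (a b c d : Fin 2) :
    fr2 m (fun A B => fr2 m (X A B) c d) a b =
      fr2 m (fun C D => fr2 m (fun A B => X A B C D) a b) c d := by
  simp only [fr2, fr, Fin.sum_univ_two]
  ring

theorem fr4_innerDiv (hm : m 0 0 * m 1 1 - m 0 1 * m 1 0 = 1)
    (P : Fin 2 → Fin 2 → Fin 2 → Fin 2 → Fin 2 → Fin 2 → ℂ) :
    fr4 m (innerDiv P) = innerDiv (fr6 m P) := by
  ext b c d f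
  have h1 : fr4 m (innerDiv P) b c d f = ∑ G, ∑ L, eps G L *
      (fun L G => fr2 m (fun B C => fr2 m (fun D F => P F L B C D G) d f) b c) L G := by
    have h : ∀ B C, fr2 m (innerDiv P B C) d f = _ := fun B C =>
      fr2_sum_eps (fun D F L G => P F L B C D G) d f
    simp only [fr4, h]
    exact fr2_sum_eps (fun B C L G => fr2 m (fun D F => P F L B C D G) d f) b c
  rw [h1, contraction_frame hm]
  refine Finset.sum_congr rfl fun G _ => Finset.sum_congr rfl fun L _ => ?_
  congr 1
  rw [← fr2_fr2_comm]
  have h2 : ∀ B C, fr2 m (fun L G => fr2 m (fun D F => P F L B C D G) d f) L G =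
      fr2 m (fun F L => fr2 m (P F L B C) d G) f L := by
    intro B C
    simp only [fr2, fr, Fin.sum_univ_two]
    ring
  simp only [h2, fr6, fr4]
  rw [fr2_fr2_comm]

theorem fr2_xiPart (hm : m 0 0 * m 1 1 - m 0 1 * m 1 0 = 1)
    (K : Fin 2 → Fin 2 → Fin 2 → Fin 2 → ℂ) :
    fr2 m (xiPart K) = xiPart (fr4 m K) := by
  have h1 : ∀ a b, fr2 m (fun A B => ∑ D, ∑ E, eps D E * K A E B D) a b =
      ∑ D, ∑ E, eps D E * fr4 m K a E b D := by
    intro a b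
    rw [fr2_sum_eps (fun A B E D => K A E B D), contraction_frame hm]
    refine Finset.sum_congr rfl fun D _ => Finset.sum_congr rfl fun E _ => ?_
    congr 1
    simp only [fr4, fr2, fr, Fin.sum_univ_two]
    ring
  ext a b
  unfold xiPart
  rw [← h1, ← h1]
  simp only [fr2, fr, Fin.sum_univ_two]
  ring

theorem fr2_traceLast (hm : m 0 0 * m 1 1 - m 0 1 * m 1 0 = 1)
    (Y : Fin 2 → Fin 2 → Fin 2 → Fin 2 → ℂ) :
    fr2 m (traceLast Y) = traceLast (fr4 m Y) := by
  ext a b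
  unfold traceLast
  rw [fr2_sum_eps Y, contraction_frame hm]
  refine Finset.sum_congr rfl fun D _ => Finset.sum_congr rfl fun E _ => ?_
  congr 1
  rw [← fr2_fr2_comm]
  rfl

theorem fr2_fullDiv (hm : m 0 0 * m 1 1 - m 0 1 * m 1 0 = 1)
    (P : Fin 2 → Fin 2 → Fin 2 → Fin 2 → Fin 2 → Fin 2 → ℂ) :
    fr2 m (fullDiv P) = fullDiv (fr6 m P) := by
  -- The double contraction is split into two nested single ones, so that each can be moved to the
  -- frame separately.
  have h0 : ∀ P A B, fullDiv P A B = ∑ F, ∑ R,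
      eps F R * traceLast (fun R F T Q => P R T F Q A B) R F := by
    intro P A B
    simp only [fullDiv, traceLast, Fin.sum_univ_two]
    ring
  ext a b
  have h1 : fr2 m (fullDiv P) a b = ∑ F, ∑ R, eps F R *
      (fun R F => traceLast (fun R F T Q => fr2 m (P R T F Q) a b) R F) R F := by
    simp only [fullDiv, traceLast, fr2, fr, Fin.sum_univ_two]
    ring
  rw [h1, contraction_frame hm, h0]
  refine Finset.sum_congr rfl fun F _ => Finset.sum_congr rfl fun R _ => ?_
  congr 1
  have h2 := congrFun₂ (fr2_traceLast hm fun R F T Q => fr2 m (P R T F Q) a b) R F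
  refine h2.trans ?_
  simp only [traceLast]
  refine Finset.sum_congr rfl fun Q _ => Finset.sum_congr rfl fun T _ => ?_
  congr 1
  simp only [fr6, fr4]
  have h3 : ∀ X : Fin 2 → Fin 2 → Fin 2 → Fin 2 → ℂ,
      fr2 m (fun A B => fr2 m (fun D F => X A D B F) T Q) R F =
        fr2 m (fun A B => fr2 m (fun D F => X A B D F) F Q) R T := by
    intro X
    simp only [fr2, fr, Fin.sum_univ_two]
    ring
  exact h3 fun R T F Q => fr2 m (P R T F Q) a b

theorem fr4_symProd (κ l : Fin 2 → Fin 2 → ℂ) :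
    fr4 m (symProd κ l) = symProd (fr2 m κ) (fr2 m l) := by
  ext a b c d
  simp only [symProd, fr4, fr2, fr, Fin.sum_univ_two]
  ring

/-- The Leibniz form of `𝒟Ψ` keeps its shape in every frame, so the adapted-frame computation may
start from it. -/
theorem fr6_leibniz (a : Fin 2 → Fin 2 → ℂ) (f : ℂ) (κ : Fin 2 → Fin 2 → ℂ)
    (K : Fin 2 → Fin 2 → Fin 2 → Fin 2 → ℂ) (A B C D E F : Fin 2) :
    fr6 m (fun A B C D E F => a A B * symProd κ κ C D E F + f * symProd κ (K A B) C D E F)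
      A B C D E F =
    fr2 m a A B * symProd (fr2 m κ) (fr2 m κ) C D E F +
      f * symProd (fr2 m κ) (fr4 m K A B) C D E F := by
  have h1 : ∀ A B, fr4 m (fun C D E F =>
      a A B * symProd κ κ C D E F + f * symProd κ (K A B) C D E F) C D E F =
      a A B * symProd (fr2 m κ) (fr2 m κ) C D E F +
        f * symProd (fr2 m κ) (fr2 m (K A B)) C D E F := by
    intro A B
    rw [← fr4_symProd, ← fr4_symProd]
    simp only [fr4, fr2, fr, Fin.sum_univ_two]
    ring
  have h2 : ∀ (κ' : Fin 2 → Fin 2 → ℂ) (k : ℂ) (X : Fin 2 → Fin 2 → Fin 2 → Fin 2 → ℂ),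
      fr2 m (fun A B => a A B * k + f * symProd κ' (X A B) C D E F) A B =
      fr2 m a A B * k + f * symProd κ' (fun c d => fr2 m (fun A B => X A B c d) A B) C D E F := by
    intro κ' k X
    simp only [symProd, fr2, fr, Fin.sum_univ_two]
    ring
  simp only [fr6, h1, h2]
  rfl

theorem fr4_c3Tensor (hm : m 0 0 * m 1 1 - m 0 1 * m 1 0 = 1) (κ : Fin 2 → Fin 2 → ℂ)
    (Y : Fin 2 → Fin 2 → Fin 2 → Fin 2 → ℂ)
    (P : Fin 2 → Fin 2 → Fin 2 → Fin 2 → Fin 2 → Fin 2 → ℂ)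
    (Ψ K : Fin 2 → Fin 2 → Fin 2 → Fin 2 → ℂ) :
    fr4 m (c3Tensor κ Y P Ψ K) =
      c3Tensor (fr2 m κ) (fr4 m Y) (fr6 m P) (fr4 m Ψ) (fr4 m K) := by
  have h : ∀ S T U : Fin 2 → Fin 2 → Fin 2 → Fin 2 → ℂ, ∀ a b c d,
      fr4 m (fun A B C D => S A B C D + 2 * T A B C D + U A B C D) a b c d =
        fr4 m S a b c d + 2 * fr4 m T a b c d + fr4 m U a b c d := by
    intro S T U a b c d
    simp only [fr4, fr2, fr, Fin.sum_univ_two]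
    ring
  ext a b c d
  unfold c3Tensor
  rw [h, fr4_contractLast hm, fr4_contractLast hm, fr4_innerDiv hm, fr4_contractXi hm,
    fr2_xiPart hm]

end FrameConditions

/-! ### The pointwise computation of (C3) in an adapted frame. -/

section AdaptedFrame

@[simp] theorem eps_zero_zero : eps 0 0 = 0 := rfl
@[simp] theorem eps_zero_one : eps 0 1 = 1 := rfl
@[simp] theorem eps_one_zero : eps 1 0 = -1 := rfl
@[simp] theorem eps_one_one : eps 1 1 = 0 := rfl

/-- Pointwise first order data in a frame: `Ψ = f κκ`, its Sen derivative given by the Leibniz rule,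
(C1) and the constraint. -/
structure FrameData (κ a : Fin 2 → Fin 2 → ℂ) (f : ℂ) (K Y : Fin 2 → Fin 2 → Fin 2 → Fin 2 → ℂ) :
    Prop where
  κ_symm : ∀ A B, κ A B = κ B A
  a_symm : ∀ A B, a A B = a B A
  K_symm_left : ∀ A B C D, K A B C D = K B A C D
  K_symm_right : ∀ A B C D, K A B C D = K A B D C
  Y_symm_left : ∀ A B C D, Y A B C D = Y B A C D
  Y_symm_right : ∀ A B C D, Y A B C D = Y A C B D
  killing : SymVanish K
  constraint : ∀ A B, fullDiv (fun A B C D E F => a A B * symProd κ κ C D E F +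
    (2 * f) * symProd κ (K A B) C D E F) A B - (1 / 2) * traceLast Y A B = 0

/-- The tensor of (C3) for `FrameData`. -/
def frameC3 (κ a : Fin 2 → Fin 2 → ℂ) (f : ℂ) (K Y : Fin 2 → Fin 2 → Fin 2 → Fin 2 → ℂ) :
    Fin 2 → Fin 2 → Fin 2 → Fin 2 → ℂ :=
  c3Tensor κ Y (fun A B C D E F => a A B * symProd κ κ C D E F +
    (2 * f) * symProd κ (K A B) C D E F) (fun A B C D => f * symProd κ κ A B C D) K

variable {κ a : Fin 2 → Fin 2 → ℂ} {f : ℂ} {K Y : Fin 2 → Fin 2 → Fin 2 → Fin 2 → ℂ}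

/-- (C1) solved for one component of `𝒟κ` per equation, in a form usable as rewrite rules. -/
theorem FrameData.killing_solved (h : FrameData κ a f K Y) :
    K 0 0 0 0 = 0 ∧ K 0 0 0 1 = -K 0 1 0 0 ∧ K 0 0 1 1 = -K 1 1 0 0 - 4 * K 0 1 0 1 ∧
      K 0 1 1 1 = -K 1 1 0 1 ∧ K 1 1 1 1 = 0 := by
  obtain ⟨h0, h1, h2, h3, h4⟩ := h.killing
  have l := h.K_symm_left 1 0
  have r := fun A B => h.K_symm_right A B 1 0
  simp only [l, r] at h1 h2 h3
  exact ⟨h0, by linear_combination h1 / 2, by linear_combination h2, by linear_combination h3 / 2,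
    h4⟩

theorem FrameData.typeD (h : FrameData κ a f K Y) {e : ℂ} (he : e ≠ 0) (k0 : κ 0 0 = 0)
    (k1 : κ 0 1 = e) (k2 : κ 1 1 = 0) :
    SymVanish (frameC3 κ a f K Y) ↔
      Y 1 1 1 1 = 0 ∧ Y 1 1 1 0 = 0 ∧ Y 0 0 0 1 = 0 ∧ Y 0 0 0 0 = 0 := by
  have k3 : κ 1 0 = e := (h.κ_symm 1 0).trans k1
  obtain ⟨q0, q1, q2, q3, q4⟩ := h.killing_solved
  have l := h.K_symm_left 1 0
  have r := fun A B => h.K_symm_right A B 1 0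
  have ha := h.a_symm 1 0
  have y1 := h.Y_symm_left 1 0
  have y2 := fun A => h.Y_symm_right A 1 0
  have c0 := h.constraint 0 0
  have c1 := h.constraint 0 1
  have c2 := h.constraint 1 1
  simp only [fullDiv, traceLast, symProd, Fin.sum_univ_two, eps_zero_zero, eps_zero_one,
    eps_one_zero, eps_one_one, k0, k1, k2, k3, l, r, ha, y1, y2, q0, q1, q2, q3, q4] at c0 c1 c2
  ring_nf at c0 c1 c2
  have w0 : frameC3 κ a f K Y 0 0 0 0 = e * Y 0 0 0 0 := by
    simp only [frameC3, c3Tensor, contractLast, innerDiv, contractXi, xiPart, symProd,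
      Fin.sum_univ_two, eps_zero_zero, eps_zero_one,
      eps_one_zero, eps_one_one, k0, k1, k2, k3, l, r, ha, y1, y2, q0, q1, q2, q3, q4]
    ring_nf
  -- In this component and the next two, the derivative terms add up to `-6 e` times a component of
  -- the divergence of `Ψ`, which the constraint turns into a trace of `Y`. In the two extreme
  -- components they cancel without the constraint.
  have w1 : frameC3 κ a f K Y 0 0 0 1 + frameC3 κ a f K Y 0 0 1 0 + frameC3 κ a f K Y 0 1 0 0 +
      frameC3 κ a f K Y 1 0 0 0 = 2 * e * Y 0 0 0 1 := by
    simp only [frameC3, c3Tensor, contractLast, innerDiv, contractXi, xiPart, symProd,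
      Fin.sum_univ_two, eps_zero_zero, eps_zero_one,
      eps_one_zero, eps_one_one, k0, k1, k2, k3, l, r, ha, y1, y2, q0, q1, q2, q3, q4]
    linear_combination -6 * e * c0
  have w2 : frameC3 κ a f K Y 0 0 1 1 + frameC3 κ a f K Y 0 1 0 1 + frameC3 κ a f K Y 0 1 1 0 +
      frameC3 κ a f K Y 1 0 0 1 + frameC3 κ a f K Y 1 0 1 0 + frameC3 κ a f K Y 1 1 0 0 = 0 := by
    simp only [frameC3, c3Tensor, contractLast, innerDiv, contractXi, xiPart, symProd,
      Fin.sum_univ_two, eps_zero_zero, eps_zero_one,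
      eps_one_zero, eps_one_one, k0, k1, k2, k3, l, r, ha, y1, y2, q0, q1, q2, q3, q4]
    linear_combination -6 * e * c1
  have w3 : frameC3 κ a f K Y 0 1 1 1 + frameC3 κ a f K Y 1 0 1 1 + frameC3 κ a f K Y 1 1 0 1 +
      frameC3 κ a f K Y 1 1 1 0 = -2 * e * Y 1 1 1 0 := by
    simp only [frameC3, c3Tensor, contractLast, innerDiv, contractXi, xiPart, symProd,
      Fin.sum_univ_two, eps_zero_zero, eps_zero_one,
      eps_one_zero, eps_one_one, k0, k1, k2, k3, l, r, ha, y1, y2, q0, q1, q2, q3, q4]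
    linear_combination -6 * e * c2
  have w4 : frameC3 κ a f K Y 1 1 1 1 = -e * Y 1 1 1 1 := by
    simp only [frameC3, c3Tensor, contractLast, innerDiv, contractXi, xiPart, symProd,
      Fin.sum_univ_two, eps_zero_zero, eps_zero_one,
      eps_one_zero, eps_one_one, k0, k1, k2, k3, l, r, ha, y1, y2, q0, q1, q2, q3, q4]
    ring_nf
  constructor
  · rintro ⟨v0, v1, -, v3, v4⟩
    rw [w0] at v0
    rw [w1] at v1
    rw [w3] at v3
    rw [w4] at v4
    simp only [mul_eq_zero, he, neg_eq_zero, OfNat.ofNat_ne_zero, false_or] at v0 v1 v3 v4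
    exact ⟨v4, v3, v1, v0⟩
  · rintro ⟨v4, v3, v1, v0⟩
    exact ⟨by rw [w0, v0, mul_zero], by rw [w1, v1, mul_zero], w2, by rw [w3, v3, mul_zero],
      by rw [w4, v4, mul_zero]⟩

/-- The hypothesis `hK` holds for the derivative of a null `κ = o o`; it does not follow from the
values of `κ` at the point. -/
theorem FrameData.typeN (h : FrameData κ a f K Y) (k0 : κ 0 0 = 0)
    (k1 : κ 0 1 = 0) (k2 : κ 1 1 = 1) (hK : ∀ A B, K A B 0 0 = 0) :
    SymVanish (frameC3 κ a f K Y) ↔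
      Y 1 1 0 1 = 0 ∧ Y 1 1 0 0 = 0 ∧ Y 1 0 0 1 = 0 ∧ Y 1 0 0 0 = 0 ∧ Y 0 0 0 1 = 0 ∧
        Y 0 0 0 0 = 0 := by
  have k3 : κ 1 0 = 0 := (h.κ_symm 1 0).trans k1
  obtain ⟨q0, q1, q2, q3, q4⟩ := h.killing_solved
  have l := h.K_symm_left 1 0
  have r := fun A B => h.K_symm_right A B 1 0
  have ha := h.a_symm 1 0
  have y1 := h.Y_symm_left 1 0
  have y2 := fun A => h.Y_symm_right A 1 0
  have c0 := h.constraint 0 0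
  have c1 := h.constraint 0 1
  have c2 := h.constraint 1 1
  simp only [fullDiv, traceLast, symProd, Fin.sum_univ_two, eps_zero_zero, eps_zero_one,
    eps_one_zero, eps_one_one, k0, k1, k2, k3, l, r, ha, y1, y2, q1, q2, q3, q4, hK] at c0 c1 c2
  ring_nf at c0 c1 c2
  have w0 : frameC3 κ a f K Y 0 0 0 0 = 0 := by
    simp only [frameC3, c3Tensor, contractLast, innerDiv, contractXi, xiPart, symProd,
      Fin.sum_univ_two, eps_zero_zero, eps_zero_one,
      eps_one_zero, eps_one_one, k0, k1, k2, k3, l, r, ha, y1, y2, q1, q2, q3, q4, hK]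
    ring_nf
  have w1 : frameC3 κ a f K Y 0 0 0 1 + frameC3 κ a f K Y 0 0 1 0 + frameC3 κ a f K Y 0 1 0 0 +
      frameC3 κ a f K Y 1 0 0 0 = Y 0 0 0 0 := by
    simp only [frameC3, c3Tensor, contractLast, innerDiv, contractXi, xiPart, symProd,
      Fin.sum_univ_two, eps_zero_zero, eps_zero_one,
      eps_one_zero, eps_one_one, k0, k1, k2, k3, l, r, ha, y1, y2, q1, q2, q3, q4, hK]
    ring_nf
  have w2 : frameC3 κ a f K Y 0 0 1 1 + frameC3 κ a f K Y 0 1 0 1 + frameC3 κ a f K Y 0 1 1 0 +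
      frameC3 κ a f K Y 1 0 0 1 + frameC3 κ a f K Y 1 0 1 0 + frameC3 κ a f K Y 1 1 0 0 =
      3 * Y 1 0 0 0 := by
    simp only [frameC3, c3Tensor, contractLast, innerDiv, contractXi, xiPart, symProd,
      Fin.sum_univ_two, eps_zero_zero, eps_zero_one,
      eps_one_zero, eps_one_one, k0, k1, k2, k3, l, r, ha, y1, y2, q1, q2, q3, q4, hK]
    ring_nf
  have w3 : frameC3 κ a f K Y 0 1 1 1 + frameC3 κ a f K Y 1 0 1 1 + frameC3 κ a f K Y 1 1 0 1 +
      frameC3 κ a f K Y 1 1 1 0 = 3 * Y 1 1 0 0 := by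
    simp only [frameC3, c3Tensor, contractLast, innerDiv, contractXi, xiPart, symProd,
      Fin.sum_univ_two, eps_zero_zero, eps_zero_one,
      eps_one_zero, eps_one_one, k0, k1, k2, k3, l, r, ha, y1, y2, q1, q2, q3, q4, hK]
    ring_nf
  have w4 : frameC3 κ a f K Y 1 1 1 1 = Y 1 1 0 1 := by
    simp only [frameC3, c3Tensor, contractLast, innerDiv, contractXi, xiPart, symProd,
      Fin.sum_univ_two, eps_zero_zero, eps_zero_one,
      eps_one_zero, eps_one_one, k0, k1, k2, k3, l, r, ha, y1, y2, q1, q2, q3, q4, hK]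
    linear_combination -2 * c2
  -- The `00` and `01` components of the divergence vanish here, so the constraint kills the
  -- corresponding traces of `Y`. These two identities raise four conditions to six.
  have d0 : Y 1 0 0 0 = Y 0 0 0 1 := by
    simp only [y1, y2]
    linear_combination -2 * c0
  have d1 : Y 1 1 0 0 = Y 1 0 0 1 := by
    simp only [y1, y2]
    linear_combination -2 * c1
  constructor
  · rintro ⟨-, v1, v2, v3, v4⟩
    rw [w1] at v1
    rw [w2] at v2
    rw [w3] at v3
    rw [w4] at v4
    simp only [mul_eq_zero, OfNat.ofNat_ne_zero, false_or] at v2 v3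
    exact ⟨v4, v3, d1 ▸ v3, v2, d0 ▸ v2, v1⟩
  · rintro ⟨v4, v3, -, v2, -, v1⟩
    exact ⟨w0, w1.trans v1, by rw [w2, v2, mul_zero], by rw [w3, v3, mul_zero], w4.trans v4⟩

end AdaptedFrame

/-! ### The Leibniz rule and the symmetries of the Sen derivative. -/

namespace SpacelikeHypersurface

variable {M : Type*} [TopologicalSpace M] [ChartedSpace (EuclideanSpace ℝ (Fin 4)) M]
  [IsManifold (𝓡 4) ∞ M] {𝓜 : SpinSpacetime M}
  {S : Type*} [TopologicalSpace S] [ChartedSpace (EuclideanSpace ℝ (Fin 3)) S]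
  [IsManifold (𝓡 3) ∞ S] (H : SpacelikeHypersurface 𝓜 S)

theorem differential_add {f g : S → ℂ} {p : S} (hf : MDifferentiableAt (𝓡 3) 𝓘(ℝ, ℂ) f p)
    (hg : MDifferentiableAt (𝓡 3) 𝓘(ℝ, ℂ) g p) (v : TangentSpace (𝓡 3) p) :
    differential (fun q => f q + g q) p v = differential f p v + differential g p v := by
  have h := (hf.hasMFDerivAt.add hg.hasMFDerivAt).mfderiv
  exact DFunLike.congr_fun h v

theorem differential_mul {f g : S → ℂ} {p : S} (hf : MDifferentiableAt (𝓡 3) 𝓘(ℝ, ℂ) f p)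
    (hg : MDifferentiableAt (𝓡 3) 𝓘(ℝ, ℂ) g p) (v : TangentSpace (𝓡 3) p) :
    differential (fun q => f q * g q) p v =
      f p * differential g p v + g p * differential f p v := by
  have h := (hf.hasMFDerivAt.mul hg.hasMFDerivAt).mfderiv
  exact DFunLike.congr_fun h v

theorem differential_const (c : ℂ) (p : S) (v : TangentSpace (𝓡 3) p) :
    differential (fun _ => c) p v = 0 := by
  have h := (hasMFDerivAt_const (I := 𝓡 3) (I' := 𝓘(ℝ, ℂ)) c p).mfderiv
  exact DFunLike.congr_fun h v

theorem differential_congr {f g : S → ℂ} {p : S} (h : f =ᶠ[nhds p] g)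
    (v : TangentSpace (𝓡 3) p) : differential f p v = differential g p v := by
  have h1 := h.mfderiv_eq (I := 𝓡 3) (I' := 𝓘(ℝ, ℂ))
  exact DFunLike.congr_fun h1 v

theorem dirDeriv_add {f g : S → ℂ} {p : S} (hf : MDifferentiableAt (𝓡 3) 𝓘(ℝ, ℂ) f p)
    (hg : MDifferentiableAt (𝓡 3) 𝓘(ℝ, ℂ) g p) (w : Fin 4 → ℂ) :
    H.dirDeriv w (fun q => f q + g q) p = H.dirDeriv w f p + H.dirDeriv w g p := by
  simp only [dirDeriv, differential_add hf hg]
  ring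

theorem dirDeriv_mul {f g : S → ℂ} {p : S} (hf : MDifferentiableAt (𝓡 3) 𝓘(ℝ, ℂ) f p)
    (hg : MDifferentiableAt (𝓡 3) 𝓘(ℝ, ℂ) g p) (w : Fin 4 → ℂ) :
    H.dirDeriv w (fun q => f q * g q) p = f p * H.dirDeriv w g p + g p * H.dirDeriv w f p := by
  simp only [dirDeriv, differential_mul hf hg]
  ring

theorem dirDeriv_const (c : ℂ) (p : S) (w : Fin 4 → ℂ) : H.dirDeriv w (fun _ => c) p = 0 := by
  simp [dirDeriv, differential_const]

theorem dirDeriv_congr {f g : S → ℂ} {p : S} (h : f =ᶠ[nhds p] g) (w : Fin 4 → ℂ) :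
    H.dirDeriv w f p = H.dirDeriv w g p := by
  simp only [dirDeriv, differential_congr h]

theorem senVec_symm (p : S) (A B : Fin 2) : H.senVec p A B = H.senVec p B A := by
  ext a
  simp only [senVec]
  congr 1
  exact Finset.sum_congr rfl fun _ _ => add_comm _ _

/-- The connection coefficients `Γ_{AB C}^Q` of the Sen derivative. -/
def senConn (p : S) (A B C Q : Fin 2) : ℂ :=
  ∑ a, H.senVec p A B a * 𝓜.spinConnection (H.emb p) a C Q

theorem sen_two (φ : S → Spinor 2) (p : S) (A B C D : Fin 2) :
    H.sen φ p A B ![C, D] = H.dirDeriv (H.senVec p A B) (fun q => φ q ![C, D]) p -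
      ((∑ Q, H.senConn p A B C Q * φ p ![Q, D]) + ∑ Q, H.senConn p A B D Q * φ p ![C, Q]) := by
  have u0 : ∀ Q, Function.update ![C, D] 0 Q = ![Q, D] := fun Q => by
    ext k; fin_cases k <;> rfl
  have u1 : ∀ Q, Function.update ![C, D] 1 Q = ![C, Q] := fun Q => by
    ext k; fin_cases k <;> rfl
  unfold sen
  rw [Fin.sum_univ_two]
  simp only [u0, u1]
  rfl

theorem sen_four (φ : S → Spinor 4) (p : S) (A B C D E F : Fin 2) :
    H.sen φ p A B ![C, D, E, F] =
      H.dirDeriv (H.senVec p A B) (fun q => φ q ![C, D, E, F]) p -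
      ((∑ Q, H.senConn p A B C Q * φ p ![Q, D, E, F]) +
        (∑ Q, H.senConn p A B D Q * φ p ![C, Q, E, F]) +
        (∑ Q, H.senConn p A B E Q * φ p ![C, D, Q, F]) +
        ∑ Q, H.senConn p A B F Q * φ p ![C, D, E, Q]) := by
  have u0 : ∀ Q, Function.update ![C, D, E, F] 0 Q = ![Q, D, E, F] := fun Q => by
    ext k; fin_cases k <;> rfl
  have u1 : ∀ Q, Function.update ![C, D, E, F] 1 Q = ![C, Q, E, F] := fun Q => by
    ext k; fin_cases k <;> rfl
  have u2 : ∀ Q, Function.update ![C, D, E, F] 2 Q = ![C, D, Q, F] := fun Q => by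
    ext k; fin_cases k <;> rfl
  have u3 : ∀ Q, Function.update ![C, D, E, F] 3 Q = ![C, D, E, Q] := fun Q => by
    ext k; fin_cases k <;> rfl
  unfold sen
  rw [Fin.sum_univ_four]
  simp only [u0, u1, u2, u3]
  rfl

theorem sen_symm_left {n : ℕ} (φ : S → Spinor n) (p : S) (A B : Fin 2) :
    H.sen φ p A B = H.sen φ p B A := by
  unfold sen
  rw [H.senVec_symm p A B]

/-- Components of a valence two spinor as a function of two indices. -/
abbrev curry2 (T : Spinor 2) (A B : Fin 2) : ℂ := T ![A, B]

theorem _root_.IsSymmetricSpinor.swap {T : Spinor 2} (h : IsSymmetricSpinor T) (A B : Fin 2) :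
    T ![A, B] = T ![B, A] := by
  rw [← h (Equiv.swap 0 1)]
  congr 1
  ext k
  fin_cases k <;> rfl

/-- Symmetry is needed in a neighbourhood, because the components of `κ` are differentiated. -/
theorem sen_symm_right {κ : S → Spinor 2} {p : S}
    (h : ∀ᶠ q in nhds p, IsSymmetricSpinor (κ q)) (A B C D : Fin 2) :
    H.sen κ p A B ![C, D] = H.sen κ p A B ![D, C] := by
  have h1 : (fun q => κ q ![C, D]) =ᶠ[nhds p] fun q => κ q ![D, C] :=
    h.mono fun q hq => hq.swap C D
  have h2 := fun X Y => h.self_of_nhds.swap X Y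
  rw [sen_two, sen_two, H.dirDeriv_congr h1]
  simp only [h2 _ D, h2 _ C]
  rw [add_comm (∑ Q, H.senConn p A B C Q * κ p ![D, Q])]

/-- The Sen derivative of `f κ_{(AB} κ_{CD)}`. -/
theorem sen_eq_of_eq_symProd {κ : S → Spinor 2} {Ψ : S → Spinor 4} {f : S → ℂ} {p : S}
    (hκ : ∀ i, MDifferentiableAt (𝓡 3) 𝓘(ℝ, ℂ) (fun q => κ q i) p)
    (hf : MDifferentiableAt (𝓡 3) 𝓘(ℝ, ℂ) f p)
    (h : ∀ᶠ q in nhds p, ∀ A B C D, Ψ q ![A, B, C, D] =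
      f q * symProd (curry2 (κ q)) (curry2 (κ q)) A B C D)
    (A B C D E F : Fin 2) :
    H.sen Ψ p A B ![C, D, E, F] =
      H.dirDeriv (H.senVec p A B) f p * symProd (curry2 (κ p)) (curry2 (κ p)) C D E F +
        2 * f p * symProd (curry2 (κ p)) (fun X Y => H.sen κ p A B ![X, Y]) C D E F := by
  have h0 := h.self_of_nhds
  have h1 : (fun q => Ψ q ![C, D, E, F]) =ᶠ[nhds p] fun q => f q * ((1 / 3) *
      (κ q ![C, D] * κ q ![E, F] + κ q ![C, E] * κ q ![D, F] + κ q ![C, F] * κ q ![D, E])) :=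
    h.mono fun q hq => by
      simp only [hq, symProd]
      ring
  have hc : MDifferentiableAt (𝓡 3) 𝓘(ℝ, ℂ) (fun _ : S => (1 / 3 : ℂ)) p :=
    mdifferentiableAt_const
  have hm : ∀ i j, MDifferentiableAt (𝓡 3) 𝓘(ℝ, ℂ) (fun q => κ q i * κ q j) p :=
    fun i j => (hκ i).mul (hκ j)
  have m1 := hm ![C, D] ![E, F]
  have m2 := hm ![C, E] ![D, F]
  have m3 := hm ![C, F] ![D, E]
  have m4 : MDifferentiableAt (𝓡 3) 𝓘(ℝ, ℂ) (fun q => κ q ![C, D] * κ q ![E, F] +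
    κ q ![C, E] * κ q ![D, F]) p := m1.add m2
  have m5 : MDifferentiableAt (𝓡 3) 𝓘(ℝ, ℂ) (fun q => κ q ![C, D] * κ q ![E, F] +
    κ q ![C, E] * κ q ![D, F] + κ q ![C, F] * κ q ![D, E]) p := m4.add m3
  have m6 : MDifferentiableAt (𝓡 3) 𝓘(ℝ, ℂ) (fun q => (1 / 3) * (κ q ![C, D] * κ q ![E, F] +
    κ q ![C, E] * κ q ![D, F] + κ q ![C, F] * κ q ![D, E])) p := hc.mul m5
  rw [sen_four, H.dirDeriv_congr h1, H.dirDeriv_mul hf m6,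
    H.dirDeriv_mul hc m5, H.dirDeriv_add m4 m3, H.dirDeriv_add m1 m2,
    H.dirDeriv_mul (hκ _) (hκ _), H.dirDeriv_mul (hκ _) (hκ _), H.dirDeriv_mul (hκ _) (hκ _),
    dirDeriv_const]
  simp only [h0, symProd, sen_two, Fin.sum_univ_two]
  ring

/-- The Sen derivative of a null spinor `o_A o_B` vanishes when contracted with `o^A o^B`. -/
theorem fr4_sen_null {κ : S → Spinor 2} {l : S → Fin 2 → ℂ} {p : S}
    (hl : ∀ A, MDifferentiableAt (𝓡 3) 𝓘(ℝ, ℂ) (fun q => l q A) p)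
    (h : ∀ᶠ q in nhds p, ∀ A B, κ q ![A, B] = l q A * l q B)
    {m : Fin 2 → Fin 2 → ℂ} (hm : fr m (l p) 0 = 0) (a b : Fin 2) :
    fr4 m (fun A B C D => H.sen κ p A B ![C, D]) a b 0 0 = 0 := by
  have h0 := h.self_of_nhds
  have h1 : ∀ A B, fr2 m (fun C D => H.sen κ p A B ![C, D]) 0 0 = 0 := by
    intro A B
    have h2 : ∀ C D, H.sen κ p A B ![C, D] =
        l p C * (H.dirDeriv (H.senVec p A B) (fun q => l q D) p -
          ∑ Q, H.senConn p A B D Q * l p Q) +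
        l p D * (H.dirDeriv (H.senVec p A B) (fun q => l q C) p -
          ∑ Q, H.senConn p A B C Q * l p Q) := by
      intro C D
      have h3 : (fun q => κ q ![C, D]) =ᶠ[nhds p] fun q => l q C * l q D :=
        h.mono fun q hq => hq C D
      rw [sen_two, H.dirDeriv_congr h3, H.dirDeriv_mul (hl C) (hl D)]
      simp only [h0, Fin.sum_univ_two]
      ring
    simp only [h2]
    have h4 : ∀ X : Fin 2 → ℂ, fr2 m (fun C D => l p C * X D + l p D * X C) 0 0 =
        2 * fr m (l p) 0 * fr m X 0 := by
      intro X
      simp only [fr2, fr, Fin.sum_univ_two]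
      ring
    rw [h4 fun D => H.dirDeriv (H.senVec p A B) (fun q => l q D) p -
          ∑ Q, H.senConn p A B D Q * l p Q, hm, mul_zero, zero_mul]
  unfold fr4
  simp only [h1]
  simp [fr2, fr]

theorem xi_eq_xiPart (κ : S → Spinor 2) (p : S) (A B : Fin 2) :
    H.xi κ p ![A, B] = xiPart (fun A B C D => H.sen κ p A B ![C, D]) A B := by
  have hu : (Finset.univ : Finset (Equiv.Perm (Fin 2))) = {1, Equiv.swap 0 1} := by decide
  have hne : (1 : Equiv.Perm (Fin 2)) ≠ Equiv.swap 0 1 := by decide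
  unfold xi symmetrize xiPart
  rw [hu, Finset.sum_pair hne]
  simp

end SpacelikeHypersurface

/-! ### Symmetries in a frame, and the algebraic consequence of (C2). -/

section FrameSymmetries

variable {m : Fin 2 → Fin 2 → ℂ}

theorem fr2_swap {T : Fin 2 → Fin 2 → ℂ} (h : ∀ A B, T A B = T B A) (a b : Fin 2) :
    fr2 m T a b = fr2 m T b a := by
  simp only [fr2, fr, Fin.sum_univ_two, h 1 0]
  ring

theorem fr4_swap01 {T : Fin 2 → Fin 2 → Fin 2 → Fin 2 → ℂ}
    (h : ∀ A B C D, T A B C D = T B A C D) (a b c d : Fin 2) :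
    fr4 m T a b c d = fr4 m T b a c d := by
  simp only [fr4, fr2, fr, Fin.sum_univ_two, h 1 0]
  ring

theorem fr4_swap12 {T : Fin 2 → Fin 2 → Fin 2 → Fin 2 → ℂ}
    (h : ∀ A B C D, T A B C D = T A C B D) (a b c d : Fin 2) :
    fr4 m T a b c d = fr4 m T a c b d := by
  simp only [fr4, fr2, fr, Fin.sum_univ_two, fun A => h A 1 0]
  ring

theorem fr4_swap23 {T : Fin 2 → Fin 2 → Fin 2 → Fin 2 → ℂ}
    (h : ∀ A B C D, T A B C D = T A B D C) (a b c d : Fin 2) :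
    fr4 m T a b c d = fr4 m T a b d c := by
  simp only [fr4, fr2, fr, Fin.sum_univ_two, fun A B => h A B 1 0]
  ring

theorem fr4_const_mul (c : ℂ) (T : Fin 2 → Fin 2 → Fin 2 → Fin 2 → ℂ) (a b c' d : Fin 2) :
    fr4 m (fun A B C D => c * T A B C D) a b c' d = c * fr4 m T a b c' d := by
  simp only [fr4, fr2, fr, Fin.sum_univ_two]
  ring

/-- In a frame adapted to a non-null `κ`, (C2) forces `Ψ` to be a multiple of `κ_{(AB} κ_{CD)}`. -/
theorem eq_symProd_of_typeD {κ : Fin 2 → Fin 2 → ℂ} {Ψ : Fin 2 → Fin 2 → Fin 2 → Fin 2 → ℂ}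
    {e : ℂ} (he : e ≠ 0) (k0 : κ 0 0 = 0) (k1 : κ 0 1 = e) (k2 : κ 1 0 = e) (k3 : κ 1 1 = 0)
    (s1 : ∀ A B C D, Ψ A B C D = Ψ B A C D) (s2 : ∀ A B C D, Ψ A B C D = Ψ A C B D)
    (s3 : ∀ A B C D, Ψ A B C D = Ψ A B D C) (h : SymVanish (contractLast κ Ψ)) (A B C D : Fin 2) :
    Ψ A B C D = (3 / 2 * (e * e)⁻¹ * Ψ 0 0 1 1) * symProd κ κ A B C D := by
  -- Here `κ` acts diagonally: the five equations multiply `Ψ_{0000}`, `Ψ_{0001}`, `Ψ_{0011}`,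
  -- `Ψ_{0111}`, `Ψ_{1111}` by `e` times `1, 2, 0, -2, -1`. The middle equation is empty and
  -- `Ψ_{0011}` stays free.
  obtain ⟨h0, h1, -, h3, h4⟩ := h
  simp only [contractLast, Fin.sum_univ_two, eps_zero_zero, eps_zero_one, eps_one_zero,
    eps_one_one, k0, k1, k2, k3, s1 1 0, fun A => s2 A 1 0, fun A B => s3 A B 1 0] at h0 h1 h3 h4
  have t0 : Ψ 0 0 0 0 = 0 := by
    refine (mul_eq_zero.1 (?_ : e * Ψ 0 0 0 0 = 0)).resolve_left he
    linear_combination h0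
  have t1 : Ψ 0 0 0 1 = 0 := by
    refine (mul_eq_zero.1 (?_ : e * Ψ 0 0 0 1 = 0)).resolve_left he
    linear_combination h1 / 2
  have t3 : Ψ 0 1 1 1 = 0 := by
    refine (mul_eq_zero.1 (?_ : e * Ψ 0 1 1 1 = 0)).resolve_left he
    linear_combination -h3 / 2
  have t4 : Ψ 1 1 1 1 = 0 := by
    refine (mul_eq_zero.1 (?_ : e * Ψ 1 1 1 1 = 0)).resolve_left he
    linear_combination -h4
  fin_cases A <;> fin_cases B <;> fin_cases C <;> fin_cases D <;>
    simp only [Fin.zero_eta, Fin.mk_one, symProd, k0, k1, k2, k3, s1 1 0, fun A => s2 A 1 0,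
      fun A B => s3 A B 1 0, t0, t1, t3, t4] <;> field_simp <;> ring

/-- In a frame adapted to a null `κ`, (C2) forces `Ψ` to be a multiple of `κ_{(AB} κ_{CD)}`. -/
theorem eq_symProd_of_typeN {κ : Fin 2 → Fin 2 → ℂ} {Ψ : Fin 2 → Fin 2 → Fin 2 → Fin 2 → ℂ}
    (k0 : κ 0 0 = 0) (k1 : κ 0 1 = 0) (k2 : κ 1 0 = 0) (k3 : κ 1 1 = 1)
    (s1 : ∀ A B C D, Ψ A B C D = Ψ B A C D) (s2 : ∀ A B C D, Ψ A B C D = Ψ A C B D)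
    (s3 : ∀ A B C D, Ψ A B C D = Ψ A B D C) (h : SymVanish (contractLast κ Ψ)) (A B C D : Fin 2) :
    Ψ A B C D = Ψ 1 1 1 1 * symProd κ κ A B C D := by
  -- Here `κ` acts as a shift: each equation involves the component of `Ψ` with one index `1` fewer,
  -- so only `Ψ_{1111}` stays free.
  obtain ⟨-, h1, h2, h3, h4⟩ := h
  simp only [contractLast, Fin.sum_univ_two, eps_zero_zero, eps_zero_one, eps_one_zero,
    eps_one_one, k0, k1, k2, k3, s1 1 0, fun A => s2 A 1 0, fun A B => s3 A B 1 0] at h1 h2 h3 h4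
  have t0 : Ψ 0 0 0 0 = 0 := by linear_combination h1
  have t1 : Ψ 0 0 0 1 = 0 := by linear_combination h2 / 3
  have t2 : Ψ 0 0 1 1 = 0 := by linear_combination h3 / 3
  have t3 : Ψ 0 1 1 1 = 0 := by linear_combination h4
  fin_cases A <;> fin_cases B <;> fin_cases C <;> fin_cases D <;>
    simp only [Fin.zero_eta, Fin.mk_one, symProd, k0, k1, k2, k3, s1 1 0, fun A => s2 A 1 0,
      fun A B => s3 A B 1 0, t0, t1, t2, t3] <;> ring

end FrameSymmetries

/-! ### The conditions at a point, transferred to an arbitrary unimodular frame. -/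

section PointwiseConditions

open SpacelikeHypersurface

variable {M : Type*} [TopologicalSpace M] [ChartedSpace (EuclideanSpace ℝ (Fin 4)) M]
  [IsManifold (𝓡 4) ∞ M] {𝓜 : SpinSpacetime M}
  {S : Type*} [TopologicalSpace S] [ChartedSpace (EuclideanSpace ℝ (Fin 3)) S]
  [IsManifold (𝓡 3) ∞ S] {H : SpacelikeHypersurface 𝓜 S}

/-- `𝒟_{AB} κ_{CD}` as a function of the four indices. -/
abbrev senTwo (H : SpacelikeHypersurface 𝓜 S) (κ : S → Spinor 2) (p : S) (A B C D : Fin 2) : ℂ :=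
  H.sen κ p A B ![C, D]

theorem condC1_iff (κ : S → Spinor 2) (p : S) : CondC1 H κ p ↔ SymVanish (senTwo H κ p) :=
  symmetrize_eq_zero_iff _

theorem condC2_iff (d : CFEInitialData H) (κ : S → Spinor 2) (p : S) :
    CondC2 d κ p ↔ SymVanish (contractLast (curry2 (κ p)) (curry4 (d.weyl p))) :=
  symmetrize_eq_zero_iff _

theorem condC3_iff (d : CFEInitialData H) (κ : S → Spinor 2) (p : S) :
    CondC3 d κ p ↔ SymVanish (c3Tensor (curry2 (κ p)) (curry4 (H.spaceCotton d.cotton p))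
      (fun A B C D E F => H.sen d.weyl p A B ![C, D, E, F]) (curry4 (d.weyl p))
      (senTwo H κ p)) := by
  unfold CondC3
  rw [symmetrize_eq_zero_iff]
  have h : ∀ S T : Fin 2 → Fin 2 → Fin 2 → Fin 2 → ℂ, S = T → (SymVanish S ↔ SymVanish T) :=
    fun _ _ h => h ▸ Iff.rfl
  refine h _ _ ?_
  ext A B C D
  simp only [c3Tensor, contractLast, innerDiv, contractXi, ← xi_eq_xiPart, Finset.mul_sum]
  rfl

theorem spaceCotton_swap01 (d : CFEInitialData H) (p : S) (A B C D : Fin 2) :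
    H.spaceCotton d.cotton p ![A, B, C, D] = H.spaceCotton d.cotton p ![B, A, C, D] := by
  unfold spaceCotton
  refine Finset.sum_congr rfl fun D' _ => ?_
  congr 1
  rw [← d.cotton_symm p D' (Equiv.swap 0 1)]
  congr 1
  ext k
  fin_cases k <;> rfl

theorem spaceCotton_swap12 (d : CFEInitialData H) (p : S) (A B C D : Fin 2) :
    H.spaceCotton d.cotton p ![A, B, C, D] = H.spaceCotton d.cotton p ![A, C, B, D] := by
  unfold spaceCotton
  refine Finset.sum_congr rfl fun D' _ => ?_
  congr 1
  rw [← d.cotton_symm p D' (Equiv.swap 1 2)]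
  congr 1
  ext k
  fin_cases k <;> rfl

variable {d : CFEInitialData H} {κ : S → Spinor 2} {f : S → ℂ} {p : S}
  {m : Fin 2 → Fin 2 → ℂ}

/-- (C3) and the first order data in a unimodular frame, when `Ψ = f κκ` near `p`. -/
theorem frameData_and_condC3_iff (hm : m 0 0 * m 1 1 - m 0 1 * m 1 0 = 1)
    (hκ : ∀ i, MDifferentiableAt (𝓡 3) 𝓘(ℝ, ℂ) (fun q => κ q i) p)
    (hκs : ∀ᶠ q in nhds p, IsSymmetricSpinor (κ q))
    (hf : MDifferentiableAt (𝓡 3) 𝓘(ℝ, ℂ) f p)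
    (h : ∀ᶠ q in nhds p, ∀ A B C D, d.weyl q ![A, B, C, D] =
      f q * symProd (curry2 (κ q)) (curry2 (κ q)) A B C D) (hC1 : CondC1 H κ p) :
    FrameData (fr2 m (curry2 (κ p))) (fr2 m fun A B => H.dirDeriv (H.senVec p A B) f p) (f p)
      (fr4 m (senTwo H κ p)) (fr4 m (curry4 (H.spaceCotton d.cotton p))) ∧
    (CondC3 d κ p ↔ SymVanish (frameC3 (fr2 m (curry2 (κ p)))
      (fr2 m fun A B => H.dirDeriv (H.senVec p A B) f p) (f p)
      (fr4 m (senTwo H κ p)) (fr4 m (curry4 (H.spaceCotton d.cotton p))))) := by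
  set a : Fin 2 → Fin 2 → ℂ := fun A B => H.dirDeriv (H.senVec p A B) f p with ha
  have hP : (fun A B C D E F => H.sen d.weyl p A B ![C, D, E, F]) = fun A B C D E F =>
      a A B * symProd (curry2 (κ p)) (curry2 (κ p)) C D E F +
        (2 * f p) * symProd (curry2 (κ p)) (senTwo H κ p A B) C D E F := by
    ext A B C D E F
    exact H.sen_eq_of_eq_symProd hκ hf h A B C D E F
  have hΨ : curry4 (d.weyl p) = fun A B C D =>
      f p * symProd (curry2 (κ p)) (curry2 (κ p)) A B C D := by
    ext A B C D
    exact h.self_of_nhds A B C D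
  have hP' : fr6 m (fun A B C D E F => H.sen d.weyl p A B ![C, D, E, F]) =
      fun A B C D E F => fr2 m a A B * symProd (fr2 m (curry2 (κ p))) (fr2 m (curry2 (κ p))) C D E F
        + (2 * f p) * symProd (fr2 m (curry2 (κ p))) (fr4 m (senTwo H κ p) A B) C D E F := by
    rw [hP]
    ext A B C D E F
    exact fr6_leibniz _ _ _ _ _ _ _ _ _ _
  have hΨ' : fr4 m (curry4 (d.weyl p)) = fun A B C D =>
      f p * symProd (fr2 m (curry2 (κ p))) (fr2 m (curry2 (κ p))) A B C D := by
    rw [hΨ]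
    ext A B C D
    rw [fr4_const_mul, fr4_symProd]
  refine ⟨⟨?_, ?_, ?_, ?_, ?_, ?_, ?_, ?_⟩, ?_⟩
  · exact fr2_swap fun A B => hκs.self_of_nhds.swap A B
  · exact fr2_swap fun A B => by simp only [ha, H.senVec_symm p A B]
  · exact fr4_swap01 fun A B C D => congrFun (H.sen_symm_left κ p A B) _
  · exact fr4_swap23 fun A B C D => H.sen_symm_right hκs A B C D
  · exact fr4_swap01 fun A B C D => spaceCotton_swap01 d p A B C D
  · exact fr4_swap12 fun A B C D => spaceCotton_swap12 d p A B C D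
  · exact (symVanish_frame hm _).2 ((condC1_iff κ p).1 hC1)
  -- The constraint is a spinor equation, so it may be contracted with the frame; covariance of
  -- divergence and trace then gives its frame form.
  · have hc : (fun A B => fullDiv (fun A B C D E F => H.sen d.weyl p A B ![C, D, E, F]) A B -
        (1 / 2) * traceLast (curry4 (H.spaceCotton d.cotton p)) A B) = fun _ _ => 0 := by
      ext A B
      exact d.weyl_constraint p A B
    have hsub : ∀ (X Y : Fin 2 → Fin 2 → ℂ) (A B : Fin 2),
        fr2 m (fun A B => X A B - (1 / 2) * Y A B) A B =
          fr2 m X A B - (1 / 2) * fr2 m Y A B := by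
      intro X Y A B
      simp only [fr2, fr, Fin.sum_univ_two]
      ring
    intro A B
    rw [← hP', ← fr2_fullDiv hm, ← fr2_traceLast hm, ← hsub]
    exact (congrArg (fun T => fr2 m T A B) hc).trans (by simp [fr2, fr])
  · rw [condC3_iff, ← symVanish_frame hm, fr4_c3Tensor hm, hP', hΨ']
    rfl

/-- `Ψ = f κκ` may be checked in a unimodular frame. -/
theorem weyl_eq_of_frame (hm : m 0 0 * m 1 1 - m 0 1 * m 1 0 = 1) {Ψ : Spinor 4} {k : Spinor 2}
    {c : ℂ} (h : ∀ A B C D, fr4 m (curry4 Ψ) A B C D =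
      c * symProd (fr2 m (curry2 k)) (fr2 m (curry2 k)) A B C D) (A B C D : Fin 2) :
    Ψ ![A, B, C, D] = c * symProd (curry2 k) (curry2 k) A B C D := by
  have h1 : curry4 Ψ = fun A B C D => c * symProd (curry2 k) (curry2 k) A B C D := by
    refine fr4_injective hm fun A B C D => ?_
    rw [h, fr4_const_mul, fr4_symProd]
  exact congrFun (congrFun (congrFun₂ h1 A B) C) D

end PointwiseConditions

/-! ### Local existence of adapted dyads. -/

section Dyad

open SpacelikeHypersurface

@[simp] theorem lowerIdx_zero (o : Fin 2 → ℂ) : lowerIdx o 0 = -o 1 := by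
  simp [lowerIdx, Fin.sum_univ_two]

@[simp] theorem lowerIdx_one (o : Fin 2 → ℂ) : lowerIdx o 1 = o 0 := by
  simp [lowerIdx, Fin.sum_univ_two]

theorem symmetrize_two (T : Spinor 2) (A B : Fin 2) :
    symmetrize T ![A, B] = (1 / 2) * (T ![A, B] + T ![B, A]) := by
  have hu : (Finset.univ : Finset (Equiv.Perm (Fin 2))) = {1, Equiv.swap 0 1} := by decide
  have hne : (1 : Equiv.Perm (Fin 2)) ≠ Equiv.swap 0 1 := by decide
  have hs : (![A, B] : Fin 2 → Fin 2) ∘ Equiv.swap 0 1 = ![B, A] := by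
    ext k
    fin_cases k <;> rfl
  unfold symmetrize
  rw [hu, Finset.sum_pair hne, hs]
  simp

theorem spinor_two_ext {S T : Spinor 2} (h : ∀ A B, S ![A, B] = T ![A, B]) : S = T := by
  ext i
  have hi : i = ![i 0, i 1] := by
    ext k
    fin_cases k <;> rfl
  rw [hi]
  exact h _ _

theorem fr4_apply (m : Fin 2 → Fin 2 → ℂ) (T : Fin 2 → Fin 2 → Fin 2 → Fin 2 → ℂ)
    (a b c d : Fin 2) : fr4 m T a b c d =
      ∑ A, ∑ B, ∑ C, ∑ D, m a A * m b B * m c C * m d D * T A B C D := by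
  simp only [fr4, fr2, fr, Fin.sum_univ_two]
  ring

theorem selfContraction_eq {k : Spinor 2} (h : IsSymmetricSpinor k) :
    selfContraction k = 2 * (k ![0, 0] * k ![1, 1] - k ![0, 1] ^ 2) := by
  simp only [selfContraction, Fin.sum_univ_two, eps_zero_zero, eps_zero_one, eps_one_zero,
    eps_one_one, h.swap 1 0]
  ring

variable {S : Type*} [TopologicalSpace S] [ChartedSpace (EuclideanSpace ℝ (Fin 3)) S]

theorem ContMDiffAt.complex_mul {f g : S → ℂ} {p : S} (hf : ContMDiffAt (𝓡 3) 𝓘(ℝ, ℂ) ∞ f p)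
    (hg : ContMDiffAt (𝓡 3) 𝓘(ℝ, ℂ) ∞ g p) :
    ContMDiffAt (𝓡 3) 𝓘(ℝ, ℂ) ∞ (fun q => f q * g q) p :=
  (contDiff_mul (𝕜 := ℝ) (𝔸 := ℂ)).contDiffAt.comp_contMDiffAt (hf.prodMk_space hg)

theorem contMDiffAt_fr {m : S → Fin 2 → Fin 2 → ℂ} {u : S → Fin 2 → ℂ} {p : S}
    (hm : ∀ a A, ContMDiffAt (𝓡 3) 𝓘(ℝ, ℂ) ∞ (fun q => m q a A) p)
    (hu : ∀ A, ContMDiffAt (𝓡 3) 𝓘(ℝ, ℂ) ∞ (fun q => u q A) p) (a : Fin 2) :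
    ContMDiffAt (𝓡 3) 𝓘(ℝ, ℂ) ∞ (fun q => fr (m q) (u q) a) p := by
  simp only [fr, Fin.sum_univ_two]
  exact ((hm a 0).complex_mul (hu 0)).add ((hm a 1).complex_mul (hu 1))

theorem contMDiffAt_fr4 {m : S → Fin 2 → Fin 2 → ℂ} {T : S → Fin 2 → Fin 2 → Fin 2 → Fin 2 → ℂ}
    {p : S} (hm : ∀ a A, ContMDiffAt (𝓡 3) 𝓘(ℝ, ℂ) ∞ (fun q => m q a A) p)
    (hT : ∀ A B C D, ContMDiffAt (𝓡 3) 𝓘(ℝ, ℂ) ∞ (fun q => T q A B C D) p) (a b c d : Fin 2) :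
    ContMDiffAt (𝓡 3) 𝓘(ℝ, ℂ) ∞ (fun q => fr4 (m q) (T q) a b c d) p :=
  contMDiffAt_fr (u := fun q A => fr (m q) (fun B => fr2 (m q) (T q A B) c d) b) hm
    (fun A => contMDiffAt_fr (u := fun q B => fr2 (m q) (T q A B) c d) hm
      (fun B => contMDiffAt_fr (u := fun q C => fr (m q) (T q A B C) d) hm
        (fun C => contMDiffAt_fr (u := fun q D => T q A B C D) hm (hT A B C) d) c) b) a

theorem contMDiffAt_cexp {f : S → ℂ} {p : S} (hf : ContMDiffAt (𝓡 3) 𝓘(ℝ, ℂ) ∞ f p) :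
    ContMDiffAt (𝓡 3) 𝓘(ℝ, ℂ) ∞ (fun q => Complex.exp (f q)) p :=
  (Complex.contDiff_exp (𝕜 := ℝ)).comp_contMDiffAt hf

theorem contMDiffAt_inv_complex {f : S → ℂ} {p : S} (hf : ContMDiffAt (𝓡 3) 𝓘(ℝ, ℂ) ∞ f p)
    (h0 : f p ≠ 0) : ContMDiffAt (𝓡 3) 𝓘(ℝ, ℂ) ∞ (fun q => (f q)⁻¹) p :=
  (contDiffAt_inv ℝ h0).comp_contMDiffAt hf

/-- Dividing by `g p` brings the values near `1`, inside the domain where the principal logarithm is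
smooth. -/
theorem exists_local_log {g : S → ℂ} {p : S} {U : Set S} (hU : IsOpen U) (hp : p ∈ U)
    (hg : ContMDiffOn (𝓡 3) 𝓘(ℝ, ℂ) ∞ g U) (h0 : g p ≠ 0) :
    ∃ L : S → ℂ, ∀ᶠ q in nhds p,
      ContMDiffAt (𝓡 3) 𝓘(ℝ, ℂ) ∞ L q ∧ Complex.exp (L q) = g q := by
  have hg' : ∀ q ∈ U, ContMDiffAt (𝓡 3) 𝓘(ℝ, ℂ) ∞ g q :=
    fun q hq => hg.contMDiffAt (hU.mem_nhds hq)
  have hdiv : ∀ q ∈ U, ContMDiffAt (𝓡 3) 𝓘(ℝ, ℂ) ∞ (fun q => g q * (g p)⁻¹) q :=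
    fun q hq => (hg' q hq).complex_mul contMDiffAt_const
  have hslit : ∀ᶠ q in nhds p, g q * (g p)⁻¹ ∈ Complex.slitPlane := by
    refine (hdiv p hp).continuousAt.eventually_mem (Complex.isOpen_slitPlane.mem_nhds ?_)
    simp [h0]
  refine ⟨fun q => Complex.log (g p) + Complex.log (g q * (g p)⁻¹), ?_⟩
  filter_upwards [hslit, hU.mem_nhds hp] with q hq hqU
  have hne : g q * (g p)⁻¹ ≠ 0 := Complex.slitPlane_ne_zero hq
  refine ⟨contMDiffAt_const.add ?_, ?_⟩
  · have hl : ContDiffAt ℝ ∞ Complex.log ((fun q => g q * (g p)⁻¹) q) :=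
      (Complex.contDiffAt_log hq).restrict_scalars ℝ
    exact ContDiffAt.comp_contMDiffAt (f := fun q => g q * (g p)⁻¹) hl (hdiv q hqU)
  · rw [Complex.exp_add, Complex.exp_log h0, Complex.exp_log hne]
    field_simp

/-- A quadratic form with nonzero discriminant is a product of two independent linear forms. The
factorisation is smooth once a smooth square root of `Δ = κ_{01}² - κ_{00} κ_{11}` is chosen. -/
theorem exists_typeDAdapted {κ : S → Spinor 2} {U : Set S} (hU : IsOpen U)
    (hκ : SmoothSpinorOn κ U) (hκs : ∀ p ∈ U, IsSymmetricSpinor (κ p)) {p : S} (hp : p ∈ U)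
    (h : selfContraction (κ p) ≠ 0) :
    ∃ V : Set S, IsOpen V ∧ p ∈ V ∧ V ⊆ U ∧
      ∃ (o ι : S → Fin 2 → ℂ) (ϰ : S → ℂ), IsTypeDAdapted κ o ι ϰ V := by
  have hκ' : ∀ i, ∀ q ∈ U, ContMDiffAt (𝓡 3) 𝓘(ℝ, ℂ) ∞ (fun q => κ q i) q :=
    fun i q hq => (hκ i).contMDiffAt (hU.mem_nhds hq)
  have hΔ : ContMDiffOn (𝓡 3) 𝓘(ℝ, ℂ) ∞
      (fun q => κ q ![0, 1] * κ q ![0, 1] - κ q ![0, 0] * κ q ![1, 1]) U := fun q hq =>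
    (((hκ' _ q hq).complex_mul (hκ' _ q hq)).sub
      ((hκ' _ q hq).complex_mul (hκ' _ q hq))).contMDiffWithinAt
  have h0 : κ p ![0, 1] * κ p ![0, 1] - κ p ![0, 0] * κ p ![1, 1] ≠ 0 := by
    intro h1
    apply h
    rw [selfContraction_eq (hκs p hp)]
    linear_combination -2 * h1
  obtain ⟨L, hL⟩ := exists_local_log hU hp hΔ h0
  -- The roots `κ_{01} ± √Δ` differ by `2√Δ ≠ 0`, so for one sign the root does not vanish at `p`
  -- and may be divided by.
  obtain ⟨σ, hσ, hs⟩ : ∃ σ : ℂ, σ * σ = 1 ∧ κ p ![0, 1] + σ * Complex.exp (L p / 2) ≠ 0 := by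
    by_cases h1 : κ p ![0, 1] + Complex.exp (L p / 2) = 0
    · refine ⟨-1, by norm_num, fun h2 => Complex.exp_ne_zero (L p / 2) ?_⟩
      linear_combination h1 / 2 - h2 / 2
    · exact ⟨1, by norm_num, by rwa [one_mul]⟩
  have hσ0 : σ ≠ 0 := by
    rintro rfl
    simp at hσ
  have hr : ∀ q, ContMDiffAt (𝓡 3) 𝓘(ℝ, ℂ) ∞ L q → ∀ c : ℂ,
      ContMDiffAt (𝓡 3) 𝓘(ℝ, ℂ) ∞ (fun q => Complex.exp (c * L q)) q :=
    fun q hq c => contMDiffAt_cexp (contMDiffAt_const.complex_mul hq)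
  obtain ⟨s, hsv⟩ : ∃ s : S → ℂ, ∀ q, s q = κ q ![0, 1] + σ * Complex.exp (1 / 2 * L q) :=
    ⟨_, fun _ => rfl⟩
  have hs' : ∀ q ∈ U, ContMDiffAt (𝓡 3) 𝓘(ℝ, ℂ) ∞ L q → ContMDiffAt (𝓡 3) 𝓘(ℝ, ℂ) ∞ s q :=
    fun q hq hLq => by
    rw [funext hsv]
    exact (hκ' _ q hq).add (contMDiffAt_const.complex_mul (hr q hLq _))
  have hsp : s p ≠ 0 := by
    rw [hsv, one_div, inv_mul_eq_div]
    exact hs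
  have hV : ∀ᶠ q in nhds p, (ContMDiffAt (𝓡 3) 𝓘(ℝ, ℂ) ∞ L q ∧ Complex.exp (L q) =
      κ q ![0, 1] * κ q ![0, 1] - κ q ![0, 0] * κ q ![1, 1]) ∧ q ∈ U ∧ s q ≠ 0 :=
    hL.and ((hU.eventually_mem hp).and
      ((hs' p hp hL.self_of_nhds.1).continuousAt.eventually_ne hsp))
  obtain ⟨V, hVsub, hVo, hpV⟩ := mem_nhds_iff.1 hV
  have hinv : ∀ q, Complex.exp (-1 / 2 * L q) * Complex.exp (1 / 2 * L q) = 1 := fun q => by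
    rw [← Complex.exp_add, ← Complex.exp_zero]
    ring_nf
  have hsq : ∀ q, Complex.exp (1 / 2 * L q) * Complex.exp (1 / 2 * L q) = Complex.exp (L q) :=
    fun q => by
    rw [← Complex.exp_add]
    ring_nf
  -- With `s = κ_{01} + σ√Δ`, the lowered factors are `(κ_{00}, s)` and a multiple of `(1,
  -- κ_{11}/s)`. The scale of `ι` is fixed by `o_A ι^A = 1`, which forces `e^ϰ = -2σ√Δ`.
  refine ⟨V, hVo, hpV, fun q hq => (hVsub hq).2.1,
    fun q => ![s q, -κ q ![0, 0]],
    fun q => ![-(1 / 2) * σ * κ q ![1, 1] * Complex.exp (-1 / 2 * L q) * (s q)⁻¹,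
      1 / 2 * σ * Complex.exp (-1 / 2 * L q)],
    fun q => Complex.log (-2 * σ) + 1 / 2 * L q, ⟨?_, ?_, ?_⟩, ?_, ?_⟩
  · intro A q hq
    obtain ⟨⟨hLq, -⟩, hqU, -⟩ := hVsub hq
    fin_cases A
    · exact (hs' q hqU hLq).contMDiffWithinAt
    · exact (hκ' ![0, 0] q hqU).neg.contMDiffWithinAt
  · intro A q hq
    obtain ⟨⟨hLq, -⟩, hqU, hsq⟩ := hVsub hq
    fin_cases A
    · exact (((contMDiffAt_const.complex_mul (hκ' ![1, 1] q hqU)).complex_mul (hr q hLq _)).complex_mul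
        (contMDiffAt_inv_complex (hs' q hqU hLq) hsq)).contMDiffWithinAt
    · exact (contMDiffAt_const.complex_mul (hr q hLq _)).contMDiffWithinAt
  · intro q hq
    obtain ⟨⟨-, hE⟩, -, hs0⟩ := hVsub hq
    have e1 := hinv q
    have e2 := hsq q
    simp only [Fin.sum_univ_two, lowerIdx_zero, lowerIdx_one, Matrix.cons_val_zero,
      Matrix.cons_val_one]
    have hsv := hsv q
    generalize Complex.exp (-1 / 2 * L q) = x at *
    generalize Complex.exp (1 / 2 * L q) = r at *
    rw [← e2] at hE
    have hkey : s q * s q - κ q ![0, 0] * κ q ![1, 1] = 2 * σ * r * s q := by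
      rw [hsv]
      linear_combination -hE - (r * r) * hσ
    field_simp
    linear_combination σ * x * hkey + 2 * r * x * s q * hσ + 2 * s q * e1
  · intro q hq
    obtain ⟨⟨hLq, -⟩, -, -⟩ := hVsub hq
    exact (contMDiffAt_const.add (contMDiffAt_const.complex_mul hLq)).contMDiffWithinAt
  · intro q hq
    obtain ⟨⟨-, hE⟩, hqU, hs0⟩ := hVsub hq
    have e1 := hinv q
    have e2 := hsq q
    have hsv := hsv q
    have h10 := (hκs q hqU).swap 1 0
    refine spinor_two_ext fun A B => ?_
    rw [Pi.smul_apply, symmetrize_two, smul_eq_mul, Complex.exp_add,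
      Complex.exp_log (mul_ne_zero (by norm_num) hσ0)]
    generalize Complex.exp (-1 / 2 * L q) = x at *
    generalize Complex.exp (1 / 2 * L q) = r at *
    rw [← e2] at hE
    -- `s` is a root of `s² - 2 κ_{01} s + κ_{00} κ_{11}`.
    have hkey : s q * s q + κ q ![0, 0] * κ q ![1, 1] = 2 * s q * κ q ![0, 1] := by
      rw [hsv]
      linear_combination hE + (r * r) * hσ
    have hone : σ * σ * (x * r) = 1 := by rw [hσ, e1, one_mul]
    fin_cases A <;> fin_cases B <;>
      simp only [Fin.zero_eta, Fin.mk_one, Matrix.cons_val_zero, Matrix.cons_val_one,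
        lowerIdx_zero, lowerIdx_one, h10]
    · linear_combination -κ q ![0, 0] * hone
    · field_simp
      linear_combination -(σ * σ * (x * r)) * hkey - 2 * κ q ![0, 1] * s q * hone
    · field_simp
      linear_combination -(σ * σ * (x * r)) * hkey - 2 * κ q ![0, 1] * s q * hone
    · field_simp
      linear_combination -2 * κ q ![1, 1] * hone

/-- A null `κ` is a symmetric matrix of rank one. Since `κ_{01}² = κ_{00} κ_{11}`, some diagonal
entry is nonzero, and a square root of it gives `o_A`. -/
theorem exists_typeNAdapted {κ : S → Spinor 2} {U : Set S} (hU : IsOpen U)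
    (hκ : SmoothSpinorOn κ U) (hκs : ∀ p ∈ U, IsSymmetricSpinor (κ p))
    (h : ∀ p ∈ U, selfContraction (κ p) = 0) {p : S} (hp : p ∈ U) (hne : κ p ≠ 0) :
    ∃ V : Set S, IsOpen V ∧ p ∈ V ∧ V ⊆ U ∧
      ∃ o ι : S → Fin 2 → ℂ, IsTypeNAdapted κ o ι V := by
  have hκ' : ∀ i, ∀ q ∈ U, ContMDiffAt (𝓡 3) 𝓘(ℝ, ℂ) ∞ (fun q => κ q i) q :=
    fun i q hq => (hκ i).contMDiffAt (hU.mem_nhds hq)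
  have hdet : ∀ q ∈ U, κ q ![0, 1] * κ q ![0, 1] = κ q ![0, 0] * κ q ![1, 1] := by
    intro q hq
    have h1 := h q hq
    rw [selfContraction_eq (hκs q hq)] at h1
    linear_combination -h1 / 2
  have key : ∀ k : Fin 2, κ p ![k, k] ≠ 0 → ∃ (L : S → ℂ) (V : Set S), IsOpen V ∧ p ∈ V ∧ V ⊆ U ∧
      ∀ q ∈ V, (∀ c : ℂ, ContMDiffAt (𝓡 3) 𝓘(ℝ, ℂ) ∞ (fun q => Complex.exp (c * L q)) q) ∧
        Complex.exp (-1 / 2 * L q) * Complex.exp (1 / 2 * L q) = 1 ∧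
        Complex.exp (1 / 2 * L q) * Complex.exp (1 / 2 * L q) = κ q ![k, k] := by
    intro k hk
    obtain ⟨L, hL⟩ := exists_local_log hU hp (hκ ![k, k]) hk
    obtain ⟨V, hVsub, hVo, hpV⟩ := mem_nhds_iff.1 (hL.and (hU.eventually_mem hp))
    refine ⟨L, V, hVo, hpV, fun q hq => (hVsub hq).2, fun q hq =>
      ⟨fun c => contMDiffAt_cexp (contMDiffAt_const.complex_mul (hVsub hq).1.1), ?_, ?_⟩⟩
    · rw [← Complex.exp_add, ← Complex.exp_zero]
      ring_nf
    · rw [← (hVsub hq).1.2, ← Complex.exp_add]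
      ring_nf
  by_cases h00 : κ p ![0, 0] = 0
  · have h11 : κ p ![1, 1] ≠ 0 := by
      intro h11
      have h01 : κ p ![0, 1] = 0 := mul_self_eq_zero.1 ((hdet p hp).trans (by rw [h00, zero_mul]))
      refine hne (spinor_two_ext fun A B => ?_)
      have h10 := (hκs p hp).swap 1 0
      fin_cases A <;> fin_cases B <;>
        simp only [Fin.zero_eta, Fin.mk_one, h10, h00, h01, h11, Pi.zero_apply]
    obtain ⟨L, V, hVo, hpV, hVU, hL⟩ := key 1 h11
    refine ⟨V, hVo, hpV, hVU,
      fun q => ![Complex.exp (1 / 2 * L q), -κ q ![0, 1] * Complex.exp (-1 / 2 * L q)],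
      fun q => ![0, Complex.exp (-1 / 2 * L q)], ⟨?_, ?_, ?_⟩, ?_⟩
    · intro A q hq
      fin_cases A
      · exact ((hL q hq).1 _).contMDiffWithinAt
      · exact ((hκ' ![0, 1] q (hVU hq)).neg.complex_mul ((hL q hq).1 _)).contMDiffWithinAt
    · intro A q hq
      fin_cases A
      · exact contMDiffWithinAt_const
      · exact ((hL q hq).1 _).contMDiffWithinAt
    · intro q hq
      simp only [Fin.sum_univ_two, lowerIdx_zero, lowerIdx_one, Matrix.cons_val_zero,
        Matrix.cons_val_one]
      linear_combination (hL q hq).2.1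
    · intro q hq
      obtain ⟨-, e1, e2⟩ := hL q hq
      have hd := hdet q (hVU hq)
      have h10 := (hκs q (hVU hq)).swap 1 0
      refine spinor_two_ext fun A B => ?_
      generalize Complex.exp (-1 / 2 * L q) = x at *
      generalize Complex.exp (1 / 2 * L q) = r at *
      fin_cases A <;> fin_cases B <;>
        simp only [Fin.zero_eta, Fin.mk_one, Matrix.cons_val_zero, Matrix.cons_val_one,
          lowerIdx_zero, lowerIdx_one, h10]
      · linear_combination -x ^ 2 * hd + x ^ 2 * κ q ![0, 0] * e2 +
          κ q ![0, 0] * (-(x * r) - 1) * e1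
      · linear_combination -κ q ![0, 1] * e1
      · linear_combination -κ q ![0, 1] * e1
      · linear_combination -e2
  · obtain ⟨L, V, hVo, hpV, hVU, hL⟩ := key 0 h00
    refine ⟨V, hVo, hpV, hVU,
      fun q => ![κ q ![0, 1] * Complex.exp (-1 / 2 * L q), -Complex.exp (1 / 2 * L q)],
      fun q => ![Complex.exp (-1 / 2 * L q), 0], ⟨?_, ?_, ?_⟩, ?_⟩
    · intro A q hq
      fin_cases A
      · exact ((hκ' ![0, 1] q (hVU hq)).complex_mul ((hL q hq).1 _)).contMDiffWithinAt
      · exact ((hL q hq).1 _).neg.contMDiffWithinAt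
    · intro A q hq
      fin_cases A
      · exact ((hL q hq).1 _).contMDiffWithinAt
      · exact contMDiffWithinAt_const
    · intro q hq
      simp only [Fin.sum_univ_two, lowerIdx_zero, lowerIdx_one, Matrix.cons_val_zero,
        Matrix.cons_val_one]
      linear_combination (hL q hq).2.1
    · intro q hq
      obtain ⟨-, e1, e2⟩ := hL q hq
      have hd := hdet q (hVU hq)
      have h10 := (hκs q (hVU hq)).swap 1 0
      refine spinor_two_ext fun A B => ?_
      generalize Complex.exp (-1 / 2 * L q) = x at *
      generalize Complex.exp (1 / 2 * L q) = r at *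
      fin_cases A <;> fin_cases B <;>
        simp only [Fin.zero_eta, Fin.mk_one, Matrix.cons_val_zero, Matrix.cons_val_one,
          lowerIdx_zero, lowerIdx_one, h10]
      · linear_combination -e2
      · linear_combination -κ q ![0, 1] * e1
      · linear_combination -κ q ![0, 1] * e1
      · linear_combination -x ^ 2 * hd + x ^ 2 * κ q ![1, 1] * e2 +
          κ q ![1, 1] * (-(x * r) - 1) * e1

end Dyad

/-! ### The equivalences in adapted dyads. -/

section Main

open SpacelikeHypersurface

variable {M : Type*} [TopologicalSpace M] [ChartedSpace (EuclideanSpace ℝ (Fin 4)) M]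
  [IsManifold (𝓡 4) ∞ M] {𝓜 : SpinSpacetime M}
  {S : Type*} [TopologicalSpace S] [ChartedSpace (EuclideanSpace ℝ (Fin 3)) S]
  [IsManifold (𝓡 3) ∞ S] {H : SpacelikeHypersurface 𝓜 S} {d : CFEInitialData H}

/-- The frame `(o, ι)`. -/
abbrev dyadFrame (o ι : S → Fin 2 → ℂ) (q : S) : Fin 2 → Fin 2 → ℂ := ![o q, ι q]

theorem IsSpinDyadOn.det {o ι : S → Fin 2 → ℂ} {V : Set S} (h : IsSpinDyadOn o ι V) {q : S}
    (hq : q ∈ V) : dyadFrame o ι q 0 0 * dyadFrame o ι q 1 1 -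
      dyadFrame o ι q 0 1 * dyadFrame o ι q 1 0 = 1 := by
  have h1 := h.normalised q hq
  simp only [Fin.sum_univ_two, lowerIdx_zero, lowerIdx_one] at h1
  simp only [dyadFrame, Matrix.cons_val_zero, Matrix.cons_val_one]
  linear_combination h1

theorem IsSpinDyadOn.contMDiffAt_weyl {o ι : S → Fin 2 → ℂ} {V : Set S}
    (h : IsSpinDyadOn o ι V) (hV : IsOpen V) {p : S} (hp : p ∈ V) (a b c e : Fin 2) :
    ContMDiffAt (𝓡 3) 𝓘(ℝ, ℂ) ∞
      (fun q => fr4 (dyadFrame o ι q) (curry4 (d.weyl q)) a b c e) p := by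
  refine contMDiffAt_fr4 (fun k A => ?_) (fun A B C D => ?_) a b c e
  · fin_cases k
    · exact (h.smooth_o A).contMDiffAt (hV.mem_nhds hp)
    · exact (h.smooth_iota A).contMDiffAt (hV.mem_nhds hp)
  · exact (d.weyl_smooth ![A, B, C, D]).contMDiffAt Filter.univ_mem

theorem cottonComponent_eq (o ι : S → Fin 2 → ℂ) (p : S) :
    cottonComponent d o ι p = (fun y : Fin 2 → Fin 2 → Fin 2 → Fin 2 → ℂ =>
      ![y 1 1 1 1, y 1 1 1 0, y 1 1 0 1, y 1 1 0 0, y 1 0 0 1, y 1 0 0 0, y 0 0 0 1, y 0 0 0 0])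
      (fr4 (dyadFrame o ι p) (curry4 (H.spaceCotton d.cotton p))) := by
  simp only [fr4_apply]
  rfl

variable {U V : Set S} {κ : S → Spinor 2} {o ι : S → Fin 2 → ℂ}

theorem IsTypeDAdapted.frame {ϰ : S → ℂ} (h : IsTypeDAdapted κ o ι ϰ V) {q : S} (hq : q ∈ V)
    (a b : Fin 2) : fr2 (dyadFrame o ι q) (curry2 (κ q)) a b =
      (!![0, -(1 / 2) * Complex.exp (ϰ q); -(1 / 2) * Complex.exp (ϰ q), 0] :
        Matrix (Fin 2) (Fin 2) ℂ) a b := by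
  have hd := h.dyad.normalised q hq
  have hk : ∀ A B, κ q ![A, B] = Complex.exp (ϰ q) * ((1 / 2) *
      (lowerIdx (o q) A * lowerIdx (ι q) B + lowerIdx (o q) B * lowerIdx (ι q) A)) := by
    intro A B
    rw [h.eq q hq, Pi.smul_apply, symmetrize_two]
    rfl
  simp only [Fin.sum_univ_two, lowerIdx_zero, lowerIdx_one] at hd
  fin_cases a <;> fin_cases b <;>
    simp [fr2, fr, Fin.sum_univ_two, hk]
  · ring
  -- The component is `-½ e^ϰ N²` with `N = o_A ι^A`, and `N² - 1 = (N + 1)(N - 1)`.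
  · linear_combination (-(1 / 2) * Complex.exp (ϰ q) * (o q 0 * ι q 1 - o q 1 * ι q 0 + 1)) * hd
  · linear_combination (-(1 / 2) * Complex.exp (ϰ q) * (o q 0 * ι q 1 - o q 1 * ι q 0 + 1)) * hd
  · ring

theorem IsTypeNAdapted.frame (h : IsTypeNAdapted κ o ι V) {q : S} (hq : q ∈ V)
    (a b : Fin 2) : fr2 (dyadFrame o ι q) (curry2 (κ q)) a b =
      (!![0, 0; 0, 1] : Matrix (Fin 2) (Fin 2) ℂ) a b := by
  have hd := h.dyad.normalised q hq
  have hk : ∀ A B, κ q ![A, B] = lowerIdx (o q) A * lowerIdx (o q) B := by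
    intro A B
    rw [h.eq q hq]
    rfl
  simp only [Fin.sum_univ_two, lowerIdx_zero, lowerIdx_one] at hd
  fin_cases a <;> fin_cases b <;>
    simp [fr2, fr, Fin.sum_univ_two, hk]
  · ring
  · ring
  · ring
  · linear_combination (o q 0 * ι q 1 - o q 1 * ι q 0 + 1) * hd

theorem condC3_iff_of_typeD (hU : IsOpen U) (hκ : SmoothSpinorOn κ U)
    (hκs : ∀ p ∈ U, IsSymmetricSpinor (κ p)) {ϰ : S → ℂ} (hV : IsOpen V) (hVU : V ⊆ U)
    (h : IsTypeDAdapted κ o ι ϰ V) (hC1 : ∀ p ∈ V, CondC1 H κ p) (hC2 : ∀ p ∈ V, CondC2 d κ p)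
    {p : S} (hp : p ∈ V) :
    CondC3 d κ p ↔ (cottonComponent d o ι p 0 = 0 ∧ cottonComponent d o ι p 1 = 0 ∧
      cottonComponent d o ι p 6 = 0 ∧ cottonComponent d o ι p 7 = 0) := by
  have he : ∀ q, -(1 / 2) * Complex.exp (ϰ q) ≠ 0 := fun q =>
    mul_ne_zero (by norm_num) (Complex.exp_ne_zero _)
  have hϰ : ContMDiffAt (𝓡 3) 𝓘(ℝ, ℂ) ∞ ϰ p := h.smooth.contMDiffAt (hV.mem_nhds hp)
  -- The factor is forced by `κ_{(00} κ_{11)} = (2/3) e²`, where `e = κ_{01} = -½ e^ϰ` in the dyad.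
  set f : S → ℂ := fun q =>
    3 / 2 * (-(1 / 2) * Complex.exp (ϰ q) * (-(1 / 2) * Complex.exp (ϰ q)))⁻¹ *
      fr4 (dyadFrame o ι q) (curry4 (d.weyl q)) 0 0 1 1 with hf
  have hfs : ContMDiffAt (𝓡 3) 𝓘(ℝ, ℂ) ∞ f p := by
    have h1 : ContMDiffAt (𝓡 3) 𝓘(ℝ, ℂ) ∞ (fun q => -(1 / 2) * Complex.exp (ϰ q)) p :=
      contMDiffAt_const.complex_mul (contMDiffAt_cexp hϰ)
    exact (contMDiffAt_const.complex_mul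
      (contMDiffAt_inv_complex (h1.complex_mul h1) (mul_ne_zero (he p) (he p)))).complex_mul
        (h.dyad.contMDiffAt_weyl hV hp 0 0 1 1)
  have hΨ : ∀ᶠ q in nhds p, ∀ A B C D, d.weyl q ![A, B, C, D] =
      f q * symProd (curry2 (κ q)) (curry2 (κ q)) A B C D := by
    filter_upwards [hV.mem_nhds hp] with q hq
    have hs := d.weyl_symm q
    have hm := h.dyad.det hq
    refine weyl_eq_of_frame hm (eq_symProd_of_typeD (he q) (h.frame hq 0 0) (h.frame hq 0 1)
      (h.frame hq 1 0) (h.frame hq 1 1) (fr4_swap01 hs.swap01) (fr4_swap12 hs.swap12)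
      (fr4_swap23 hs.swap23) ?_)
    rw [← fr4_contractLast hm, symVanish_frame hm]
    exact (condC2_iff d κ q).1 (hC2 q hq)
  have hκd : ∀ i, MDifferentiableAt (𝓡 3) 𝓘(ℝ, ℂ) (fun q => κ q i) p := fun i =>
    ((hκ i).contMDiffAt (hU.mem_nhds (hVU hp))).mdifferentiableAt (by simp)
  have hκe : ∀ᶠ q in nhds p, IsSymmetricSpinor (κ q) :=
    (hU.eventually_mem (hVU hp)).mono hκs
  obtain ⟨hdata, hiff⟩ := frameData_and_condC3_iff (h.dyad.det hp) hκd hκe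
    (hfs.mdifferentiableAt (by simp)) hΨ (hC1 p hp)
  rw [hiff, hdata.typeD (he p) (h.frame hp 0 0) (h.frame hp 0 1) (h.frame hp 1 1),
    cottonComponent_eq]
  rfl

theorem condC3_iff_of_typeN (hU : IsOpen U) (hκ : SmoothSpinorOn κ U)
    (hκs : ∀ p ∈ U, IsSymmetricSpinor (κ p)) (hV : IsOpen V) (hVU : V ⊆ U)
    (h : IsTypeNAdapted κ o ι V) (hC1 : ∀ p ∈ V, CondC1 H κ p) (hC2 : ∀ p ∈ V, CondC2 d κ p)
    {p : S} (hp : p ∈ V) :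
    CondC3 d κ p ↔ (cottonComponent d o ι p 2 = 0 ∧ cottonComponent d o ι p 3 = 0 ∧
      cottonComponent d o ι p 4 = 0 ∧ cottonComponent d o ι p 5 = 0 ∧
      cottonComponent d o ι p 6 = 0 ∧ cottonComponent d o ι p 7 = 0) := by
  -- Here `f = Ψ_{1111}`, because `κ_{11} = 1` in the dyad.
  have hfs := h.dyad.contMDiffAt_weyl (d := d) hV hp 1 1 1 1
  have hΨ : ∀ᶠ q in nhds p, ∀ A B C D, d.weyl q ![A, B, C, D] =
      fr4 (dyadFrame o ι q) (curry4 (d.weyl q)) 1 1 1 1 *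
        symProd (curry2 (κ q)) (curry2 (κ q)) A B C D := by
    filter_upwards [hV.mem_nhds hp] with q hq
    have hs := d.weyl_symm q
    have hm := h.dyad.det hq
    refine weyl_eq_of_frame hm (eq_symProd_of_typeN (h.frame hq 0 0) (h.frame hq 0 1)
      (h.frame hq 1 0) (h.frame hq 1 1) (fr4_swap01 hs.swap01) (fr4_swap12 hs.swap12)
      (fr4_swap23 hs.swap23) ?_)
    rw [← fr4_contractLast hm, symVanish_frame hm]
    exact (condC2_iff d κ q).1 (hC2 q hq)
  have hκd : ∀ i, MDifferentiableAt (𝓡 3) 𝓘(ℝ, ℂ) (fun q => κ q i) p := fun i =>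
    ((hκ i).contMDiffAt (hU.mem_nhds (hVU hp))).mdifferentiableAt (by simp)
  have hκe : ∀ᶠ q in nhds p, IsSymmetricSpinor (κ q) :=
    (hU.eventually_mem (hVU hp)).mono hκs
  obtain ⟨hdata, hiff⟩ := frameData_and_condC3_iff (h.dyad.det hp) hκd hκe
    (hfs.mdifferentiableAt (by simp)) hΨ (hC1 p hp)
  have hl : ∀ A, MDifferentiableAt (𝓡 3) 𝓘(ℝ, ℂ) (fun q => lowerIdx (o q) A) p := by
    intro A
    have ho : ∀ B, ContMDiffAt (𝓡 3) 𝓘(ℝ, ℂ) ∞ (fun q => o q B) p := fun B =>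
      (h.dyad.smooth_o B).contMDiffAt (hV.mem_nhds hp)
    fin_cases A
    · simp only [Fin.zero_eta, lowerIdx_zero]
      exact (ho 1).neg.mdifferentiableAt (by simp)
    · simp only [Fin.mk_one, lowerIdx_one]
      exact (ho 0).mdifferentiableAt (by simp)
  have hκo : ∀ᶠ q in nhds p, ∀ A B, κ q ![A, B] = lowerIdx (o q) A * lowerIdx (o q) B := by
    filter_upwards [hV.mem_nhds hp] with q hq A B
    rw [h.eq q hq]
    rfl
  have hnull : fr (dyadFrame o ι p) (lowerIdx (o p)) 0 = 0 := by
    simp only [fr, dyadFrame, Fin.sum_univ_two, lowerIdx_zero, lowerIdx_one, Matrix.cons_val_zero]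
    ring
  rw [hiff, hdata.typeN (h.frame hp 0 0) (h.frame hp 0 1) (h.frame hp 1 1)
    (H.fr4_sen_null hl hκo hnull), cottonComponent_eq]
  rfl

end Main

end

theorem mainTheorem3
    {M : Type*} [TopologicalSpace M] [ChartedSpace (EuclideanSpace ℝ (Fin 4)) M]
    [IsManifold (𝓡 4) ∞ M] (𝓜 : SpinSpacetime M)
    {S : Type*} [TopologicalSpace S] [ChartedSpace (EuclideanSpace ℝ (Fin 3)) S]
    [IsManifold (𝓡 3) ∞ S] (H : SpacelikeHypersurface 𝓜 S) (d : CFEInitialData H)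
    (U : Set S) (hU : IsOpen U) (κ : S → Spinor 2) (hκ : SmoothSpinorOn κ U)
    (hκs : ∀ p ∈ U, IsSymmetricSpinor (κ p)) :
    ((∀ p ∈ U, selfContraction (κ p) ≠ 0) →
      (∀ p ∈ U, ∃ V : Set S, IsOpen V ∧ p ∈ V ∧ V ⊆ U ∧
        ∃ (o ι : S → Fin 2 → ℂ) (ϰ : S → ℂ), IsTypeDAdapted κ o ι ϰ V) ∧
      (∀ (V : Set S) (o ι : S → Fin 2 → ℂ) (ϰ : S → ℂ), IsOpen V → V ⊆ U →
        IsTypeDAdapted κ o ι ϰ V →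
        (∀ p ∈ V, CondC1 H κ p) → (∀ p ∈ V, CondC2 d κ p) →
        ∀ p ∈ V, CondC3 d κ p ↔
          (cottonComponent d o ι p 0 = 0 ∧ cottonComponent d o ι p 1 = 0 ∧
            cottonComponent d o ι p 6 = 0 ∧ cottonComponent d o ι p 7 = 0))) ∧
    ((∀ p ∈ U, selfContraction (κ p) = 0 ∧ κ p ≠ 0) →
      (∀ p ∈ U, ∃ V : Set S, IsOpen V ∧ p ∈ V ∧ V ⊆ U ∧
        ∃ o ι : S → Fin 2 → ℂ, IsTypeNAdapted κ o ι V) ∧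
      (∀ (V : Set S) (o ι : S → Fin 2 → ℂ), IsOpen V → V ⊆ U →
        IsTypeNAdapted κ o ι V →
        (∀ p ∈ V, CondC1 H κ p) → (∀ p ∈ V, CondC2 d κ p) →
        ∀ p ∈ V, CondC3 d κ p ↔
          (cottonComponent d o ι p 2 = 0 ∧ cottonComponent d o ι p 3 = 0 ∧
            cottonComponent d o ι p 4 = 0 ∧ cottonComponent d o ι p 5 = 0 ∧
            cottonComponent d o ι p 6 = 0 ∧ cottonComponent d o ι p 7 = 0))) := by
  refine ⟨fun h => ⟨fun p hp => exists_typeDAdapted hU hκ hκs hp (h p hp), ?_⟩,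
    fun h => ⟨fun p hp => exists_typeNAdapted hU hκ hκs (fun q hq => (h q hq).1) hp (h p hp).2,
      ?_⟩⟩
  · intro V o ι ϰ hV hVU had hC1 hC2 p hp
    exact condC3_iff_of_typeD hU hκ hκs hV hVU had hC1 hC2 hp
  · intro V o ι hV hVU had hC1 hC2 p hp
    exact condC3_iff_of_typeN hU hκ hκs hV hVU had hC1 hC2 hp
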